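/- Let $\alpha$ be a finite measure on a measurable space $(\Omega,\mathcal F)$ with $a:=\alpha(\Omega)>0$, and let $\tilde m$ be a Dirichlet process with parameter $\alpha$, that is, a random probability measure on $(\Omega,\mathcal F)$ such that, for every finite measurable partition $C_1,\dots,C_{n+1}$ of $\Omega$, the vector $(\tilde m(C_1),\dots,\tilde m(C_n))$ has the Dirichlet distribution with parameter $(\alpha(C_1),\dots,\alpha(C_n),\alpha(C_{n+1}))$ (a mass whose parameter is $0$ being almost surely $0$). Let $f_1,\dots,f_d$ be measurable functions from $\Omega$ to $\mathbb R$ such that $$\int_\Omega \log(1+|f_k|)\,d\alpha<+\infty,\qquad k=1,\dots,d,$$ and suppose that $\mathbf f=(f_1,\dots,f_d)$ is not affinely $\alpha$-degenerate, that is, there are no $\mathbf v\in\mathbb R^d\setminus\{0\}$ and $b\in\mathbb R$ with $\alpha\{\langle \mathbf v,\mathbf f\rangle=b\}=a$. Then, almost surely, every $f_k$ is $\tilde m$-integrable, and the law of the random vector $(\tilde m(f_1),\dots,\tilde m(f_d))$, where $\tilde m(f_k)=\int_\Omega f_k\,d\tilde m$, is absolutely continuous with respect to Lebesgue measure on $\mathbb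 R^d$. -/

import Mathlib

open MeasureTheory ProbabilityTheory

/-- The Lebesgue density of the Dirichlet distribution with parameters `b 0, …, b n > 0`, as the
law of the first `n` coordinates, on the open simplex `{u | 0 < u i for all i, ∑ u i < 1}`. -/
noncomputable def dirichletPDFReal {n : ℕ} (b : Fin (n + 1) → ℝ) (u : Fin n → ℝ) : ℝ :=
  open Classical in
  if (∀ i, 0 < u i) ∧ ∑ i, u i < 1 then
    Real.Gamma (∑ i, b i) / (∏ i, Real.Gamma (b i)) *
      ((∏ i, u i ^ (b i.castSucc - 1)) * (1 - ∑ i, u i) ^ (b (Fin.last n) - 1))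
  else 0

/-- The Dirichlet distribution on `ℝⁿ` with (positive) parameters `b 0, …, b n`. -/
noncomputable def dirichletMeasure {n : ℕ} (b : Fin (n + 1) → ℝ) : Measure (Fin n → ℝ) :=
  volume.withDensity fun u => ENNReal.ofReal (dirichletPDFReal b u)

/-- `m` is a Dirichlet process with parameter `α`: a random probability measure `s ↦ m s` on `Ω`,
defined on the probability space `(S, P)`, such that for every finite measurable partition
`C 0, …, C n` of `Ω` the vector of the masses of the first `n` sets has the Dirichlet distribution
with parameters `α (C 0), …, α (C n)`. As usual, a zero parameter means that the corresponding
mass vanishes almost surely; this is the clause `null`, and partitions into sets of positive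
`α`-measure are the clause `law`. -/
structure IsDirichletProcess {Ω S : Type*} [MeasurableSpace Ω] [MeasurableSpace S]
    (α : Measure Ω) (P : Measure S) (m : Kernel S Ω) : Prop where
  /-- Every realization is a probability measure. -/
  markov : IsMarkovKernel m
  /-- Sets with parameter zero have random mass zero. -/
  null : ∀ C : Set Ω, MeasurableSet C → α C = 0 → ∀ᵐ s ∂P, m s C = 0
  /-- The finite-dimensional distributions are Dirichlet. -/
  law : ∀ (n : ℕ) (C : Fin (n + 1) → Set Ω), (∀ i, MeasurableSet (C i)) →
    Pairwise (Function.onFun Disjoint C) → ⋃ i, C i = Set.univ → (∀ i, 0 < α (C i)) →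
    HasLaw (fun s (i : Fin n) => (m s).real (C i.castSucc))
      (dirichletMeasure fun i => α.real (C i)) P

/-- `f = (f 0, …, f (d - 1))` is affinely `α`-degenerate: it lies `α`-almost everywhere in an
affine hyperplane `{x | ⟨v, x⟩ = c}`. -/
def IsAffinelyDegenerate {Ω : Type*} [MeasurableSpace Ω] {d : ℕ} (α : Measure Ω)
    (f : Fin d → Ω → ℝ) : Prop :=
  ∃ v : Fin d → ℝ, v ≠ 0 ∧ ∃ c : ℝ, α {ω | ∑ j, v j * f j ω = c} = α Set.univ

/-- The random vector of means `(m(f 0), …, m(f (d - 1)))`. -/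
noncomputable def meanVector {Ω S : Type*} [MeasurableSpace Ω] [MeasurableSpace S] {d : ℕ}
    (m : Kernel S Ω) (f : Fin d → Ω → ℝ) (s : S) : Fin d → ℝ :=
  fun k => ∫ ω, f k ω ∂(m s)

/-- The vector of means is a genuine random vector, so that `Measure.map` gives its law. -/
theorem measurable_meanVector {Ω S : Type*} [MeasurableSpace Ω] [MeasurableSpace S] {d : ℕ}
    (m : Kernel S Ω) [IsMarkovKernel m] (f : Fin d → Ω → ℝ) (hf : ∀ k, Measurable (f k)) :
    Measurable (meanVector m f) :=
  measurable_pi_lambda _ fun k =>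
    ((hf k).stronglyMeasurable.integral_kernel (κ := m)).measurable

/-! Let `F = (f 0, …, f (d - 1))`. Nondegeneracy says that the support of the law of `F` under `α`
spans `ℝᵈ` affinely, so it contains `d + 1` affinely independent points. Affine independence is an
open condition: small closed balls around these points can be chosen so that any selection of one
point per ball still spans (`exists_balls_spanning`). The preimages of the balls, together with the
remainder if it is not null, partition `Ω` up to a null set.

Write `W` for the random masses of the cells and `X` for the averages of `F` over them, so that the
mean vector is `∑ W i • X i`. Two facts finish the proof. First, `W` and `X` are independent
(`indepFun_masses_setAverage`): masses are normalized independent gamma variables, and the total of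
a gamma vector is independent of its proportions (`indepFun_sum_proportions`), hence block totals
are independent of the proportions inside the blocks. Second, balls are closed and convex, so the
averages stay in them and `X` spans affinely. With `X = x` frozen, the mean is the quotient of the
two components of `∑ g i • (1, x i)` for a gamma vector `g`; this linear map is onto `ℝ × ℝᵈ` and
`g` has a density, so the quotient avoids null sets (`gammaPi_proportions_sum_smul_mem_eq_zero`).
Fubini then integrates over `x`.

Integrability of the `f k` rests on the tail bound `P(m A > x) ≤ C * (1 - log x) * α A`, uniform in
`A`, applied to dyadic levels of `|f k|` with Borel–Cantelli. -/

/-! ### Densities of product measures -/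

theorem lintegral_fin_prod_eq_prod {n : ℕ} (μ : Fin n → Measure ℝ) [∀ i, SigmaFinite (μ i)]
    (f : Fin n → ℝ → ENNReal) (hf : ∀ i, Measurable (f i)) :
    ∫⁻ x, ∏ i, f i (x i) ∂Measure.pi μ = ∏ i, ∫⁻ t, f i t ∂μ i := by
  induction n with
  | zero => simp
  | succ n ih =>
    rw [← (measurePreserving_piFinSuccAbove μ 0).symm.lintegral_comp (by fun_prop)]
    simp only [Fin.prod_univ_succ, MeasurableEquiv.piFinSuccAbove_symm_apply,
      Fin.insertNthEquiv_apply, Fin.insertNth_zero, Fin.cons_zero, Fin.cons_succ]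
    simp only [Fin.zero_succAbove]
    simp only [cast_eq]
    rw [lintegral_prod_mul (g := fun y : Fin n → ℝ => ∏ i, f i.succ (y i)) (hf 0).aemeasurable
      (Finset.measurable_fun_prod _ fun i _ => (hf _).comp (measurable_pi_apply i)).aemeasurable,
      ih _ _ (fun i => hf _)]

theorem pi_withDensity_fin {n : ℕ} (f : Fin n → ℝ → ENNReal) (hf : ∀ i, Measurable (f i))
    [∀ i, SigmaFinite (volume.withDensity (f i))] :
    Measure.pi (fun i => volume.withDensity (f i)) =
      (volume : Measure (Fin n → ℝ)).withDensity fun x => ∏ i, f i (x i) := by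
  refine (Measure.pi_eq fun s hs => ?_)
  rw [withDensity_apply _ (MeasurableSet.univ_pi hs),
    ← lintegral_indicator (MeasurableSet.univ_pi hs)]
  have : ((Set.univ.pi s).indicator fun x : Fin n → ℝ => ∏ i, f i (x i)) =
      fun x => ∏ i, (s i).indicator (f i) (x i) := by
    funext x
    by_cases hx : x ∈ Set.univ.pi s
    · rw [Set.indicator_of_mem hx]
      exact Finset.prod_congr rfl fun i _ => (Set.indicator_of_mem (hx i trivial) _).symm
    · rw [Set.indicator_of_notMem hx]
      obtain ⟨i, hi⟩ : ∃ i, x i ∉ s i := by simpa using hx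
      exact (Finset.prod_eq_zero (Finset.mem_univ i) (Set.indicator_of_notMem hi _)).symm
  rw [this, volume_pi, lintegral_fin_prod_eq_prod _ _ fun i => (hf i).indicator (hs i)]
  exact Finset.prod_congr rfl fun i _ => by
    rw [lintegral_indicator (hs i), withDensity_apply _ (hs i)]

/-! ### From independent gamma variables to the Dirichlet distribution -/

/-- The gamma density with rate `1`, supported on the open half-line. -/
noncomputable def gammaDensity (a t : ℝ) : ℝ :=
  if 0 < t then t ^ (a - 1) * Real.exp (-t) / Real.Gamma a else 0

theorem measurable_gammaDensity (a : ℝ) : Measurable (gammaDensity a) :=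
  Measurable.ite measurableSet_Ioi (by fun_prop) measurable_const

theorem gammaDensity_nonneg {a : ℝ} (ha : 0 < a) (t : ℝ) : 0 ≤ gammaDensity a t := by
  have := Real.Gamma_pos_of_pos ha
  unfold gammaDensity
  split_ifs <;> positivity

/-- The two densities can differ only at `0`, a null point. With the open half-line, the
factorization into total and proportions holds at every point, not just almost everywhere. -/
theorem gammaMeasure_one_eq (a : ℝ) :
    gammaMeasure a 1 = volume.withDensity fun t => ENNReal.ofReal (gammaDensity a t) := by
  refine withDensity_congr_ae ?_
  filter_upwards [Measure.ae_ne volume (0 : ℝ)] with t ht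
  simp only [gammaPDF_eq, gammaDensity]
  rcases lt_or_gt_of_ne ht with h | h
  · rw [if_neg (not_le.2 h), if_neg (not_lt.2 h.le)]
  · rw [if_pos h.le, if_pos h]; simp; ring_nf

theorem lintegral_eq_smul_lintegral_comp_smul {n : ℕ} (K : (Fin n → ℝ) → ENNReal)
    {s : ℝ} (hs : 0 < s) :
    ∫⁻ y, K y = ENNReal.ofReal (s ^ n) * ∫⁻ u, K (s • u) := by
  have h := Measure.map_addHaar_smul (volume : Measure (Fin n → ℝ)) hs.ne'
  have e : MeasurableEmbedding (fun u : Fin n → ℝ => s • u) :=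
    (MeasurableEquiv.smul₀ s hs.ne').measurableEmbedding
  have h2 := e.lintegral_map (μ := volume) K
  rw [show Measure.map (fun u : Fin n → ℝ => s • u) volume = _ from h, lintegral_smul_measure] at h2
  rw [← h2, smul_eq_mul, ← mul_assoc, ← ENNReal.ofReal_mul (by positivity)]
  simp only [Module.finrank_fintype_fun_eq_card, Fintype.card_fin]
  rw [abs_of_pos (by positivity), mul_inv_cancel₀ (by positivity)]
  simp

theorem measurable_dirichletPDFReal {n : ℕ} (b : Fin (n + 1) → ℝ) :
    Measurable (dirichletPDFReal b) := by
  refine Measurable.ite ?_ (((Finset.measurable_fun_prod _ fun i _ =>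
    (measurable_pi_apply i).pow_const _).mul
    ((measurable_const.sub (Finset.measurable_fun_sum _ fun i _ =>
      measurable_pi_apply i)).pow_const _)).const_mul _) measurable_const
  refine MeasurableSet.inter ?_ (measurableSet_lt (f := fun u : Fin n → ℝ => ∑ i, u i)
    (by fun_prop) measurable_const)
  have : {u : Fin n → ℝ | ∀ i, 0 < u i} = ⋂ i, {u | 0 < u i} := by ext; simp
  change MeasurableSet {u : Fin n → ℝ | ∀ i, 0 < u i}
  rw [this]
  exact MeasurableSet.iInter fun i => measurableSet_lt measurable_const (by fun_prop)

/-- Factorization of the joint gamma density in the coordinates (total, proportions). -/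
theorem prod_gammaDensity_smul {n : ℕ} {a : Fin (n + 1) → ℝ} (ha : ∀ i, 0 < a i) {s : ℝ}
    (hs : 0 < s) (u : Fin n → ℝ) :
    s ^ n * ((∏ i : Fin n, gammaDensity (a i.castSucc) (s * u i)) *
      gammaDensity (a (Fin.last n)) (s - ∑ i, s * u i)) =
      gammaDensity (∑ i, a i) s * dirichletPDFReal a u := by
  unfold dirichletPDFReal
  split_ifs with hu
  · obtain ⟨hu0, hu1⟩ := hu
    have hG : 0 < Real.Gamma (∑ i, a i) :=
      Real.Gamma_pos_of_pos (Finset.sum_pos (fun i _ => ha i) Finset.univ_nonempty)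
    have hlast : s - ∑ i, s * u i = s * (1 - ∑ i, u i) := by rw [← Finset.mul_sum]; ring
    have h1 : 0 < 1 - ∑ i, u i := by linarith
    rw [hlast]
    simp only [gammaDensity, hs, mul_pos hs (hu0 _), mul_pos hs h1, if_true]
    simp only [Real.mul_rpow hs.le (hu0 _).le, Real.mul_rpow hs.le h1.le]
    rw [Finset.prod_div_distrib, Finset.prod_mul_distrib, Finset.prod_mul_distrib,
      ← Real.exp_sum, Fin.prod_univ_castSucc (f := fun i => Real.Gamma (a i)),
      ← Real.rpow_sum_of_pos hs]
    have e1 : Real.exp (-s) = Real.exp (∑ i, -(s * u i)) * Real.exp (-(s * (1 - ∑ i, u i))) := by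
      rw [← Real.exp_add, Finset.sum_neg_distrib, ← Finset.mul_sum]; ring_nf
    have e2 : s ^ (∑ i, a i - 1) =
        s ^ n * s ^ (∑ i : Fin n, (a i.castSucc - 1)) * s ^ (a (Fin.last n) - 1) := by
      rw [← Real.rpow_natCast, ← Real.rpow_add hs, ← Real.rpow_add hs, Fin.sum_univ_castSucc,
        Finset.sum_sub_distrib]
      simp; ring_nf
    rw [e1, e2]
    field_simp
  · rw [mul_zero]
    by_cases h0 : ∀ i, 0 < u i
    · have h1 : 1 ≤ ∑ i, u i := not_lt.1 fun h => hu ⟨h0, h⟩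
      have : ¬ 0 < s - ∑ i, s * u i := by
        rw [← Finset.mul_sum]; nlinarith
      simp [gammaDensity, this]
    · obtain ⟨i, hi⟩ := not_forall.1 h0
      have : ¬ 0 < s * u i := fun h => hi (pos_of_mul_pos_right h hs.le)
      rw [Finset.prod_eq_zero (Finset.mem_univ i) (by simp [gammaDensity, this])]
      simp

/-- Positive coordinates cannot have a nonpositive total. This disposes of the half-line where the
substitution `y = s • u` is not available. -/
theorem prod_gammaDensity_of_nonpos {n : ℕ} (a : Fin (n + 1) → ℝ) {s : ℝ}
    (hs : s ≤ 0) (y : Fin n → ℝ) :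
    (∏ i : Fin n, gammaDensity (a i.castSucc) (y i)) *
      gammaDensity (a (Fin.last n)) (s - ∑ i, y i) = 0 := by
  by_cases h0 : ∀ i, 0 < y i
  · have : ¬ 0 < s - ∑ i, y i := by
      have := Finset.sum_nonneg fun i (_ : i ∈ Finset.univ) => (h0 i).le
      linarith
    simp [gammaDensity, this]
  · obtain ⟨i, hi⟩ := not_forall.1 h0
    rw [Finset.prod_eq_zero (Finset.mem_univ i) (by simp [gammaDensity, hi]), zero_mul]

/-- Integration over `ℝⁿ⁺¹` in the coordinates (total, first `n` coordinates). -/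
theorem lintegral_fin_succ_eq_lintegral_total {n : ℕ} {H : (Fin (n + 1) → ℝ) → ENNReal}
    (hH : Measurable H) :
    ∫⁻ x, H x = ∫⁻ s : ℝ, ∫⁻ y : Fin n → ℝ, H (Fin.snoc y (s - ∑ i, y i)) := by
  have hsnoc : Measurable fun z : ℝ × (Fin n → ℝ) => (Fin.snoc z.2 z.1 : Fin (n + 1) → ℝ) := by
    refine measurable_pi_lambda _ fun i => ?_
    refine Fin.lastCases ?_ (fun i => ?_) i
    · simpa using measurable_fst
    · simpa using! (measurable_pi_apply i).comp measurable_snd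
  have h2 : Measurable fun z : ℝ × (Fin n → ℝ) => H (Fin.snoc z.2 (z.1 - ∑ i, z.2 i)) :=
    hH.comp (hsnoc.comp (g := fun z : ℝ × (Fin n → ℝ) => (Fin.snoc z.2 z.1 : Fin (n + 1) → ℝ))
      (f := fun z : ℝ × (Fin n → ℝ) => (z.1 - ∑ i, z.2 i, z.2)) (by fun_prop))
  rw [← (volume_preserving_piFinSuccAbove (fun _ => ℝ) (Fin.last n)).symm.lintegral_comp hH]
  have e : ∀ z : ℝ × (Fin n → ℝ), (MeasurableEquiv.piFinSuccAbove (fun _ => ℝ)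
      (Fin.last n)).symm z = (Fin.snoc z.2 z.1 : Fin (n + 1) → ℝ) := fun z => by
    simp [MeasurableEquiv.piFinSuccAbove_symm_apply, Fin.insertNthEquiv]
  simp only [e]
  rw [Measure.volume_eq_prod,
    lintegral_prod_symm' (fun z : ℝ × (Fin n → ℝ) => H (Fin.snoc z.2 z.1)) (hH.comp hsnoc),
    lintegral_lintegral_swap
      (f := fun (s : ℝ) (y : Fin n → ℝ) => H (Fin.snoc y (s - ∑ i, y i))) h2.aemeasurable]
  -- For fixed `y`, passing from the last coordinate to the total is a translation, so the Jacobian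
  -- is `1`.
  exact lintegral_congr fun y =>
    (lintegral_sub_right_eq_self (fun t => H (Fin.snoc y t)) (∑ i, y i)).symm

/-- For independent gamma variables, the total is gamma distributed, the vector of proportions has
the Dirichlet distribution, and both are independent. -/
theorem map_pi_gammaMeasure_fin {n : ℕ} {a : Fin (n + 1) → ℝ} (ha : ∀ i, 0 < a i) :
    (Measure.pi fun i => gammaMeasure (a i) 1).map
      (fun x => (∑ i, x i, fun i : Fin n => x i.castSucc / ∑ j, x j)) =
      (gammaMeasure (∑ i, a i) 1).prod (dirichletMeasure a) := by
  have hp : ∀ i, IsProbabilityMeasure (gammaMeasure (a i) 1) := fun i =>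
    isProbabilityMeasure_gammaMeasure (ha i) one_pos
  have hA : 0 < ∑ i, a i := Finset.sum_pos (fun i _ => ha i) Finset.univ_nonempty
  have hm := measurable_gammaDensity
  have hD := measurable_dirichletPDFReal a
  have hM : Measurable fun x : Fin (n + 1) → ℝ => ∏ i, ENNReal.ofReal (gammaDensity (a i) (x i)) :=
    Finset.measurable_fun_prod _ fun i _ => (hm _).ennreal_ofReal.comp (measurable_pi_apply i)
  have hN : Measurable fun x : Fin (n + 1) → ℝ =>
      (∑ i, x i, fun i : Fin n => x i.castSucc / ∑ j, x j) := by fun_prop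
  have hQ : Measurable fun z : ℝ × (Fin n → ℝ) => ENNReal.ofReal (gammaDensity (∑ i, a i) z.1) *
      ENNReal.ofReal (dirichletPDFReal a z.2) :=
    ((hm _).ennreal_ofReal.comp measurable_fst).mul (hD.ennreal_ofReal.comp measurable_snd)
  refine Measure.ext_of_lintegral _ fun F hF => ?_
  have hH : Measurable ((fun x : Fin (n + 1) → ℝ => ∏ i, ENNReal.ofReal (gammaDensity (a i) (x i)))
      * fun x => F (∑ i, x i, fun i : Fin n => x i.castSucc / ∑ j, x j)) := hM.mul (hF.comp hN)
  rw [lintegral_map hF hN]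
  simp only [gammaMeasure_one_eq] at hp ⊢
  rw [pi_withDensity_fin _ fun i => (hm _).ennreal_ofReal,
    lintegral_withDensity_eq_lintegral_mul _ hM
      (g := fun x => F (∑ i, x i, fun i : Fin n => x i.castSucc / ∑ j, x j)) (hF.comp hN),
    lintegral_fin_succ_eq_lintegral_total hH,
    dirichletMeasure,
    prod_withDensity (hm _).ennreal_ofReal hD.ennreal_ofReal,
    lintegral_withDensity_eq_lintegral_mul _ hQ hF, lintegral_prod _ (hQ.mul hF).aemeasurable]
  refine lintegral_congr fun s => ?_
  simp only [Pi.mul_apply, Fin.prod_univ_castSucc, Fin.snoc_castSucc,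
    Fin.snoc_last, Fin.sum_univ_castSucc]
  rw [← Fin.sum_univ_castSucc]
  have key : ∀ y : Fin n → ℝ, (∏ i : Fin n, ENNReal.ofReal (gammaDensity (a i.castSucc) (y i))) *
      ENNReal.ofReal (gammaDensity (a (Fin.last n)) (s - ∑ i, y i)) =
      ENNReal.ofReal ((∏ i : Fin n, gammaDensity (a i.castSucc) (y i)) *
        gammaDensity (a (Fin.last n)) (s - ∑ i, y i)) := fun y => by
    rw [ENNReal.ofReal_mul (Finset.prod_nonneg fun i _ => gammaDensity_nonneg (ha _) _),
      ENNReal.ofReal_prod_of_nonneg fun i _ => gammaDensity_nonneg (ha _) _]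
  simp only [key, add_sub_cancel]
  rcases le_or_gt s 0 with hs | hs
  · simp [prod_gammaDensity_of_nonpos a hs, show gammaDensity (∑ i, a i) s = 0 by
      simp [gammaDensity, not_lt.2 hs]]
  -- The substitution `y = s • u` replaces coordinates by proportions; its Jacobian `s ^ n` is the
  -- factor in `prod_gammaDensity_smul`.
  · rw [lintegral_eq_smul_lintegral_comp_smul _ hs, ← lintegral_const_mul' _ _ (by simp)]
    refine lintegral_congr fun u => ?_
    have hu : (fun i : Fin n => (s • u) i / s) = u := by
      funext i; simp [hs.ne']
    rw [hu, ← mul_assoc, ← ENNReal.ofReal_mul (by positivity),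
      ← ENNReal.ofReal_mul (gammaDensity_nonneg hA _), ← prod_gammaDensity_smul ha hs]
    simp

/-! ### Gamma vectors over arbitrary finite index types -/

/-- The law of a vector of independent gamma variables with rate `1`. -/
noncomputable def gammaPi {κ : Type*} [Fintype κ] (a : κ → ℝ) : Measure (κ → ℝ) :=
  Measure.pi fun k => gammaMeasure (a k) 1

/-- The coordinates of a vector divided by their sum. -/
noncomputable def proportions {κ : Type*} [Fintype κ] (x : κ → ℝ) : κ → ℝ :=
  fun k => x k / ∑ j, x j

theorem measurable_proportions {κ : Type*} [Fintype κ] :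
    Measurable (proportions : (κ → ℝ) → κ → ℝ) := by
  unfold proportions; fun_prop

theorem indepFun_map_iff {Ω Ω' β γ : Type*} [MeasurableSpace Ω] [MeasurableSpace Ω']
    [MeasurableSpace β] [MeasurableSpace γ] {μ : Measure Ω} [IsFiniteMeasure μ] {T : Ω → Ω'}
    (hT : AEMeasurable T μ) {f : Ω' → β} {g : Ω' → γ} (hf : Measurable f) (hg : Measurable g) :
    IndepFun f g (μ.map T) ↔ IndepFun (fun ω => f (T ω)) (fun ω => g (T ω)) μ := by
  rw [indepFun_iff_map_prod_eq_prod_map_map hf.aemeasurable hg.aemeasurable,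
    indepFun_iff_map_prod_eq_prod_map_map (f := fun ω => f (T ω)) (g := fun ω => g (T ω))
      (hf.comp_aemeasurable hT) (hg.comp_aemeasurable hT),
    AEMeasurable.map_map_of_aemeasurable (by fun_prop) hT,
    AEMeasurable.map_map_of_aemeasurable (by fun_prop) hT,
    AEMeasurable.map_map_of_aemeasurable (by fun_prop) hT]
  rfl

theorem isProbabilityMeasure_gammaMeasure_one {κ : Type*} {a : κ → ℝ} (ha : ∀ k, 0 < a k) (k : κ) :
    IsProbabilityMeasure (gammaMeasure (a k) 1) :=
  isProbabilityMeasure_gammaMeasure (ha k) one_pos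

section GammaPi

variable {κ : Type*} [Fintype κ] {a : κ → ℝ}

theorem isProbabilityMeasure_gammaPi (ha : ∀ k, 0 < a k) : IsProbabilityMeasure (gammaPi a) := by
  have := isProbabilityMeasure_gammaMeasure_one ha
  unfold gammaPi
  infer_instance

theorem measurePreserving_reindex {ι : Type*} [Fintype ι] (e : ι ≃ κ) (μ : κ → Measure ℝ)
    [∀ k, SigmaFinite (μ k)] :
    MeasurePreserving (fun (x : ι → ℝ) k => x (e.symm k)) (Measure.pi fun i => μ (e i))
      (Measure.pi μ) where
  measurable := by fun_prop
  map_eq := by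
    refine (Measure.pi_eq fun s hs => ?_).symm
    rw [Measure.map_apply (by fun_prop) (MeasurableSet.univ_pi hs)]
    have : (fun (x : ι → ℝ) k => x (e.symm k)) ⁻¹' Set.univ.pi s =
        Set.univ.pi fun i => s (e i) := by
      ext x
      simp only [Set.mem_preimage, Set.mem_univ_pi]
      exact ⟨fun h i => by simpa using h (e i), fun h k => by simpa using h (e.symm k)⟩
    rw [this, Measure.pi_pi, e.prod_comp fun k => μ k (s k)]

theorem measurePreserving_gammaPi_reindex {ι : Type*} [Fintype ι] (e : ι ≃ κ)
    (ha : ∀ k, 0 < a k) :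
    MeasurePreserving (fun (x : ι → ℝ) k => x (e.symm k)) (gammaPi fun i => a (e i))
      (gammaPi a) :=
  have := isProbabilityMeasure_gammaMeasure_one ha
  measurePreserving_reindex e fun k => gammaMeasure (a k) 1

theorem ae_pos_gammaPi (ha : ∀ k, 0 < a k) : ∀ᵐ x ∂gammaPi a, ∀ k, 0 < x k := by
  have := isProbabilityMeasure_gammaMeasure_one ha
  refine ae_all_iff.2 fun k => ?_
  have h : ∀ᵐ t ∂gammaMeasure (a k) 1, 0 < t := by
    rw [gammaMeasure_one_eq, ae_withDensity_iff (measurable_gammaDensity _).ennreal_ofReal]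
    refine ae_of_all _ fun t ht => ?_
    by_contra hn
    simp [gammaDensity, hn] at ht
  exact (Measure.tendsto_eval_ae_ae (μ := fun k => gammaMeasure (a k) 1) (i := k)).eventually h

theorem ae_sum_pos_gammaPi [Nonempty κ] (ha : ∀ k, 0 < a k) :
    ∀ᵐ x ∂gammaPi a, 0 < ∑ k, x k := by
  filter_upwards [ae_pos_gammaPi ha] with x hx
  exact Finset.sum_pos (fun k _ => hx k) Finset.univ_nonempty

theorem gammaPi_absolutelyContinuous (ha : ∀ k, 0 < a k) : gammaPi a ≪ volume := by
  let e := (Fintype.equivFin κ).symm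
  have hp := isProbabilityMeasure_gammaMeasure_one fun i => ha (e i)
  have h : (gammaPi fun i => a (e i)) ≪ volume := by
    unfold gammaPi
    simp only [gammaMeasure_one_eq] at hp ⊢
    rw [pi_withDensity_fin _ fun i => (measurable_gammaDensity _).ennreal_ofReal]
    exact withDensity_absolutelyContinuous _ _
  rw [← (measurePreserving_gammaPi_reindex e ha).map_eq, volume_pi,
    ← (measurePreserving_reindex e fun _ => volume).map_eq, ← volume_pi]
  exact h.map (by fun_prop)

/-- Completion of the first `n` proportions to the full vector of proportions. -/
def simplexCompletion {n : ℕ} (u : Fin n → ℝ) : Fin (n + 1) → ℝ := Fin.snoc u (1 - ∑ i, u i)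

theorem measurable_simplexCompletion {n : ℕ} :
    Measurable (simplexCompletion : (Fin n → ℝ) → Fin (n + 1) → ℝ) := by
  refine measurable_pi_lambda _ fun i => ?_
  refine Fin.lastCases ?_ (fun i => ?_) i
  · simp only [simplexCompletion, Fin.snoc_last]; fun_prop
  · simp only [simplexCompletion, Fin.snoc_castSucc]; fun_prop

theorem simplexCompletion_castSucc {n : ℕ} {x : Fin (n + 1) → ℝ} (hx : ∑ i, x i = 1) :
    simplexCompletion (fun i : Fin n => x i.castSucc) = x := by
  funext i
  refine Fin.lastCases ?_ (fun i => ?_) i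
  · rw [Fin.sum_univ_castSucc] at hx
    simp only [simplexCompletion, Fin.snoc_last]; linarith
  · simp [simplexCompletion]

theorem sum_proportions {x : κ → ℝ} (hx : ∑ k, x k ≠ 0) : ∑ k, proportions x k = 1 := by
  simp [proportions, ← Finset.sum_div, hx]

section Fin

variable {n : ℕ} {b : Fin (n + 1) → ℝ}

theorem map_gammaPi_fin (hb : ∀ i, 0 < b i) :
    (gammaPi b).map (fun x => (∑ i, x i, fun i : Fin n => x i.castSucc / ∑ j, x j)) =
      (gammaMeasure (∑ i, b i) 1).prod (dirichletMeasure b) :=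
  map_pi_gammaMeasure_fin hb

theorem isProbabilityMeasure_gammaMeasure_sum (hb : ∀ i, 0 < b i) :
    IsProbabilityMeasure (gammaMeasure (∑ i, b i) 1) :=
  isProbabilityMeasure_gammaMeasure
    (Finset.sum_pos (fun i _ => hb i) Finset.univ_nonempty) one_pos

instance sFinite_dirichletMeasure : SFinite (dirichletMeasure b) := by
  unfold dirichletMeasure; infer_instance

/-- The normalization of the Dirichlet density needs no beta integral: compare total masses in
`map_gammaPi_fin`, where all other measures are probabilities. -/
theorem isProbabilityMeasure_dirichletMeasure (hb : ∀ i, 0 < b i) :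
    IsProbabilityMeasure (dirichletMeasure b) := by
  have := isProbabilityMeasure_gammaMeasure_sum hb
  have := isProbabilityMeasure_gammaPi hb
  have hm : Measurable fun x : Fin (n + 1) → ℝ =>
    (∑ i, x i, fun i : Fin n => x i.castSucc / ∑ j, x j) := by fun_prop
  have := Measure.isProbabilityMeasure_map (μ := gammaPi b) hm.aemeasurable
  have h := congrArg (fun μ => μ Set.univ) (map_gammaPi_fin hb)
  simp only [measure_univ] at h
  rw [← Set.univ_prod_univ, Measure.prod_prod, measure_univ, one_mul] at h
  exact ⟨h.symm⟩

theorem map_sum_gammaPi_fin (hb : ∀ i, 0 < b i) :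
    (gammaPi b).map (fun x => ∑ i, x i) = gammaMeasure (∑ i, b i) 1 := by
  have := isProbabilityMeasure_dirichletMeasure hb
  rw [← (gammaMeasure (∑ i, b i) 1).fst_prod (ν := dirichletMeasure b), ← map_gammaPi_fin hb,
    Measure.fst, Measure.map_map measurable_fst (by fun_prop)]
  rfl

theorem map_castSucc_proportions_gammaPi (hb : ∀ i, 0 < b i) :
    (gammaPi b).map (fun x (i : Fin n) => x i.castSucc / ∑ j, x j) = dirichletMeasure b := by
  have := isProbabilityMeasure_gammaMeasure_sum hb
  rw [← (dirichletMeasure b).snd_prod (μ := gammaMeasure (∑ i, b i) 1), ← map_gammaPi_fin hb,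
    Measure.snd, Measure.map_map measurable_snd (by fun_prop)]
  rfl

theorem simplexCompletion_proportions (hb : ∀ i, 0 < b i) :
    (fun x => simplexCompletion fun i : Fin n => x i.castSucc / ∑ j, x j)
      =ᵐ[gammaPi b] proportions := by
  filter_upwards [ae_sum_pos_gammaPi hb] with x hx
  exact simplexCompletion_castSucc (sum_proportions hx.ne')

theorem map_dirichletMeasure_simplexCompletion (hb : ∀ i, 0 < b i) :
    (dirichletMeasure b).map simplexCompletion = (gammaPi b).map proportions := by
  rw [← map_castSucc_proportions_gammaPi hb,
    Measure.map_map measurable_simplexCompletion (by fun_prop)]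
  exact Measure.map_congr (simplexCompletion_proportions hb)

end Fin

/-- The product form of `map_gammaPi_fin` gives independence for the first `n` proportions. The last
one is a function of these because the total is almost surely nonzero, and an enumeration of `κ`
removes the ordering. -/
theorem indepFun_sum_proportions [Nonempty κ] (ha : ∀ k, 0 < a k) :
    HasLaw (fun x => ∑ k, x k) (gammaMeasure (∑ k, a k) 1) (gammaPi a) ∧
      IndepFun (fun x => ∑ k, x k) proportions (gammaPi a) := by
  obtain ⟨n, hn⟩ : ∃ n, Fintype.card κ = n + 1 := ⟨_, (Nat.succ_pred Fintype.card_ne_zero).symm⟩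
  let e : Fin (n + 1) ≃ κ := (Fintype.equivFinOfCardEq hn).symm
  have hb := fun i => ha (e i)
  have := isProbabilityMeasure_gammaPi hb
  have hind : IndepFun (fun x => ∑ i, x i) proportions (gammaPi fun i => a (e i)) := by
    have h := (indepFun_iff_map_prod_eq_prod_map_map (f := fun x : Fin (n + 1) → ℝ => ∑ i, x i)
      (g := fun x (i : Fin n) => x i.castSucc / ∑ j, x j) (by fun_prop) (by fun_prop)).2
      ((map_gammaPi_fin hb).trans
        (by rw [map_sum_gammaPi_fin hb, map_castSucc_proportions_gammaPi hb]))
    exact (h.comp measurable_id measurable_simplexCompletion).congr (ae_eq_refl _)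
      (simplexCompletion_proportions hb)
  have hT := measurePreserving_gammaPi_reindex e ha
  have hS : ∀ x : Fin (n + 1) → ℝ, ∑ k, x (e.symm k) = ∑ i, x i := fun x => e.symm.sum_comp x
  refine ⟨⟨by fun_prop, ?_⟩, ?_⟩
  · rw [← hT.map_eq, Measure.map_map (by fun_prop) hT.measurable, ← e.sum_comp a,
      ← map_sum_gammaPi_fin hb]
    exact congrArg (fun f => Measure.map f _) (funext hS)
  · rw [← hT.map_eq, indepFun_map_iff hT.aemeasurable (by fun_prop) measurable_proportions]
    have hR : Measurable fun (x : Fin (n + 1) → ℝ) k => x (e.symm k) := hT.measurable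
    have h := hind.comp measurable_id hR
    convert! h using 1
    · funext x; exact hS x
    · funext x k; simp only [proportions, Function.comp_apply, hS]

end GammaPi

/-! ### Independence across blocks and the masses of a Dirichlet process -/

/-- Independence within each factor of a product space implies independence of the families. -/
theorem indepFun_pi_of_indepFun {ι : Type*} [Fintype ι] {Ω E F : ι → Type*}
    [∀ i, MeasurableSpace (Ω i)] {μ : ∀ i, Measure (Ω i)} [∀ i, IsProbabilityMeasure (μ i)]
    [∀ s, TopologicalSpace (E s)] [∀ s, MeasurableSpace (E s)] [∀ s, BorelSpace (E s)]
    [∀ s, HasOuterApproxClosed (E s)]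
    [∀ t, TopologicalSpace (F t)] [∀ t, MeasurableSpace (F t)] [∀ t, BorelSpace (F t)]
    [∀ t, HasOuterApproxClosed (F t)] {X : ∀ i, Ω i → E i} {Y : ∀ i, Ω i → F i}
    (hX : ∀ i, Measurable (X i)) (hY : ∀ i, Measurable (Y i))
    (h : ∀ i, IndepFun (X i) (Y i) (μ i)) :
    IndepFun (fun (ω : ∀ i, Ω i) i => X i (ω i)) (fun (ω : ∀ i, Ω i) i => Y i (ω i))
      (Measure.pi μ) := by
  refine pi_indepFun_pi_of_prod_bcf (fun i => ((hX i).comp (measurable_pi_apply i)).aemeasurable)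
    (fun i => ((hY i).comp (measurable_pi_apply i)).aemeasurable) fun f g => ?_
  have e1 : (∏ s, f s ∘ fun ω : ∀ i, Ω i => X s (ω s)) =
      fun ω => ∏ i, (f i ∘ X i) (ω i) := by ext; simp
  have e2 : (∏ s, g s ∘ fun ω : ∀ i, Ω i => Y s (ω s)) =
      fun ω => ∏ i, (g i ∘ Y i) (ω i) := by ext; simp
  have e3 : ((fun ω : ∀ i, Ω i => ∏ i, (f i ∘ X i) (ω i)) * fun ω => ∏ i, (g i ∘ Y i) (ω i)) =
      fun ω => ∏ i, ((f i ∘ X i) * (g i ∘ Y i)) (ω i) := by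
    ext; simp [Finset.prod_mul_distrib]
  rw [e1, e2, e3, integral_fintype_prod_eq_prod, integral_fintype_prod_eq_prod,
    integral_fintype_prod_eq_prod, ← Finset.prod_mul_distrib]
  refine Finset.prod_congr rfl fun i _ => ?_
  have h' := (h i).comp (f i).continuous.measurable (g i).continuous.measurable
  exact h'.integral_mul_eq_mul_integral
    ((f i).continuous.measurable.comp (hX i)).aestronglyMeasurable
    ((g i).continuous.measurable.comp (hY i)).aestronglyMeasurable

/-- Block sums of independent gamma variables are independent of the proportions within blocks. -/
theorem indepFun_blockSum_blockProportions {ι : Type*} [Fintype ι] {κ : ι → Type*}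
    [∀ i, Fintype (κ i)] [∀ i, Nonempty (κ i)] {a : (Σ i, κ i) → ℝ} (ha : ∀ p, 0 < a p) :
    IndepFun (fun (x : (Σ i, κ i) → ℝ) i => ∑ j, x ⟨i, j⟩)
      (fun (x : (Σ i, κ i) → ℝ) i => proportions fun j => x ⟨i, j⟩) (gammaPi a) := by
  have hp := isProbabilityMeasure_gammaMeasure_one ha
  have hp' : ∀ i, IsProbabilityMeasure (gammaPi fun j => a ⟨i, j⟩) := fun i =>
    isProbabilityMeasure_gammaPi fun j => ha ⟨i, j⟩
  have hT : MeasurePreserving (fun (x : ∀ i, κ i → ℝ) (p : Σ i, κ i) => x p.1 p.2)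
      (Measure.pi fun i => gammaPi fun j => a ⟨i, j⟩) (gammaPi a) := by
    have hTm : Measurable fun (x : ∀ i, κ i → ℝ) (p : Σ i, κ i) => x p.1 p.2 := by fun_prop
    refine ⟨hTm, (Measure.pi_eq fun s hs => ?_).symm⟩
    rw [Measure.map_apply hTm (MeasurableSet.univ_pi hs)]
    have : (fun (x : ∀ i, κ i → ℝ) (p : Σ i, κ i) => x p.1 p.2) ⁻¹' Set.univ.pi s =
        Set.univ.pi fun i => Set.univ.pi fun j => s ⟨i, j⟩ := by
      ext x
      simp [Sigma.forall]
    rw [this, Measure.pi_pi, Fintype.prod_sigma]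
    exact Finset.prod_congr rfl fun i _ => Measure.pi_pi _ _
  have hprop : Measurable fun (x : (Σ i, κ i) → ℝ) i => proportions fun j => x ⟨i, j⟩ :=
    measurable_pi_lambda _ fun i => measurable_proportions.comp (by fun_prop)
  rw [← hT.map_eq, indepFun_map_iff hT.aemeasurable (by fun_prop) hprop]
  exact indepFun_pi_of_indepFun (fun i => by fun_prop) (fun i => measurable_proportions)
    fun i => (indepFun_sum_proportions fun j => ha ⟨i, j⟩).2

/-- The masses of finitely many disjoint sets that cover almost everything are distributed as the
proportions of independent gamma variables. -/
theorem IsDirichletProcess.hasLaw_masses {Ω S : Type*} [MeasurableSpace Ω] [MeasurableSpace S]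
    {α : Measure Ω} [IsFiniteMeasure α] {P : Measure S} {m : Kernel S Ω}
    (hm : IsDirichletProcess α P m) {κ : Type*} [Fintype κ] [Nonempty κ] {D : κ → Set Ω}
    (hD : ∀ k, MeasurableSet (D k)) (hdisj : Pairwise (Function.onFun Disjoint D))
    (hcover : α (⋃ k, D k)ᶜ = 0) (hpos : ∀ k, 0 < α (D k)) :
    HasLaw (fun s k => (m s).real (D k)) ((gammaPi fun k => α.real (D k)).map proportions) P := by
  have := hm.markov
  obtain ⟨n, hn⟩ : ∃ n, Fintype.card κ = n + 1 := ⟨_, (Nat.succ_pred Fintype.card_ne_zero).symm⟩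
  let e : Fin (n + 1) ≃ κ := (Fintype.equivFinOfCardEq hn).symm
  set R : Set Ω := (⋃ k, D k)ᶜ
  have hRm : MeasurableSet R := (MeasurableSet.iUnion hD).compl
  have hRD : ∀ k, Disjoint (D k) R := fun k =>
    Set.disjoint_compl_right_iff_subset.2 (Set.subset_iUnion D k)
  -- The clause `law` needs an exact partition into cells of positive measure, so the null remainder
  -- is absorbed into the last cell.
  let D' : Fin (n + 1) → Set Ω := fun i => D (e i) ∪ if i = Fin.last n then R else ∅
  have hlast : D' (Fin.last n) = D (e (Fin.last n)) ∪ R := by simp [D']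
  have hD' : ∀ i, MeasurableSet (D' i) := fun i => (hD _).union (by split_ifs <;> simp [hRm])
  have hmass : ∀ (μ : Measure Ω), μ R = 0 → ∀ i, μ.real (D' i) = μ.real (D (e i)) := by
    intro μ hμ i
    refine measureReal_congr ?_
    have : (if i = Fin.last n then R else ∅ : Set Ω) =ᵐ[μ] (∅ : Set Ω) := by
      split_ifs
      · exact ae_eq_empty.2 hμ
      · rfl
    simpa only [Set.union_empty] using! (ae_eq_refl (μ := μ) (D (e i))).union this
  have hdisj' : Pairwise (Function.onFun Disjoint D') := by
    intro i j hij
    have hde : Disjoint (D (e i)) (D (e j)) := hdisj (e.injective.ne hij)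
    simp only [Function.onFun, D', Set.disjoint_union_left, Set.disjoint_union_right]
    refine ⟨⟨hde, ?_⟩, ?_, ?_⟩
    · split_ifs <;> simp [(hRD _).symm]
    · split_ifs <;> simp [hRD _]
    · split_ifs with h1 h2 <;> simp
      exact (hij (h1.trans h2.symm)).elim
  have huniv : ⋃ i, D' i = Set.univ := by
    refine Set.eq_univ_of_forall fun ω => ?_
    by_cases hω : ω ∈ R
    · exact Set.mem_iUnion.2 ⟨Fin.last n, by rw [hlast]; exact Or.inr hω⟩
    · obtain ⟨k, hk⟩ := Set.mem_iUnion.1 (not_not.1 hω)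
      exact Set.mem_iUnion.2 ⟨e.symm k, Or.inl (by simpa using hk)⟩
  have hlaw := hm.law n D' hD' hdisj' huniv fun i =>
    (hpos (e i)).trans_le (measure_mono Set.subset_union_left)
  simp only [hmass α hcover] at hlaw
  have ha : ∀ k, 0 < α.real (D k) := fun k => ENNReal.toReal_pos (hpos k).ne' (measure_ne_top _ _)
  have hcompl : HasLaw simplexCompletion ((gammaPi fun i => α.real (D (e i))).map proportions)
      (dirichletMeasure fun i => α.real (D (e i))) :=
    ⟨measurable_simplexCompletion.aemeasurable,
      map_dirichletMeasure_simplexCompletion fun i => ha (e i)⟩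
  have hreindex : HasLaw (fun (x : Fin (n + 1) → ℝ) k => x (e.symm k))
      ((gammaPi fun k => α.real (D k)).map proportions)
      ((gammaPi fun i => α.real (D (e i))).map proportions) := by
    have hT := measurePreserving_gammaPi_reindex e ha
    refine ⟨hT.measurable.aemeasurable, ?_⟩
    rw [← hT.map_eq, Measure.map_map measurable_proportions hT.measurable,
      Measure.map_map hT.measurable measurable_proportions]
    refine congrArg (fun f => Measure.map f _) (funext fun x => funext fun k => ?_)
    simp only [proportions, Function.comp_apply, e.symm.sum_comp x]
  refine (hreindex.comp (hcompl.comp hlaw)).congr ?_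
  filter_upwards [hm.null R hRm hcover] with s hs
  funext k
  have hsum : ∑ i, (m s).real (D' i) = 1 := by
    rw [← measureReal_iUnion_fintype hdisj' hD', huniv]
    simp
  simp only [Function.comp_apply]
  rw [simplexCompletion_castSucc hsum]
  simp only [hmass _ hs, Equiv.apply_symm_apply]

/-! ### Tail bound for the masses and integrability -/

open Filter Topology

theorem lintegral_inv_Ioc {x : ℝ} (hx : 0 < x) (hx1 : x ≤ 1) :
    ∫⁻ t in Set.Ioc x 1, ENNReal.ofReal t⁻¹ = ENNReal.ofReal (-Real.log x) := by
  have hi : IntervalIntegrable (fun t : ℝ => t⁻¹) volume x 1 :=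
    intervalIntegrable_inv_iff.2 (Or.inr (by
      rw [Set.uIcc_of_le hx1]; exact fun h => absurd h.1 (not_le.2 hx)))
  rw [← ofReal_integral_eq_lintegral_ofReal
      ((intervalIntegrable_iff_integrableOn_Ioc_of_le hx1).1 hi)
      ((ae_restrict_iff' measurableSet_Ioc).2 (ae_of_all _ fun t ht =>
        inv_nonneg.2 (hx.trans ht.1).le)),
    ← intervalIntegral.integral_of_le hx1, integral_inv_of_pos hx one_pos]
  simp

/-- By compactness. Since `Γ(e) = Γ(e + 1) / e`, it yields `1 / Γ(e) ≤ e / c`, the source of the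
linear factor `e` in the gamma tail bound. -/
theorem exists_gamma_lower_bound (A : ℝ) :
    ∃ c : ℝ, 0 < c ∧ ∀ t ∈ Set.Icc 0 A, c ≤ Real.Gamma (t + 1) := by
  rcases (Set.Icc (0 : ℝ) A).eq_empty_or_nonempty with h | h
  · exact ⟨1, one_pos, by simp [h]⟩
  obtain ⟨t, ht, hmin⟩ := isCompact_Icc.exists_isMinOn h
    (f := fun t => Real.Gamma (t + 1)) (fun t ht => by
      refine (ContinuousAt.comp (g := Real.Gamma) (f := fun t : ℝ => t + 1) ?_
        (by fun_prop)).continuousWithinAt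
      refine (Real.differentiableAt_Gamma fun m => ?_).continuousAt
      have := ht.1
      have : (0 : ℝ) ≤ m := m.cast_nonneg
      linarith)
  exact ⟨_, Real.Gamma_pos_of_pos (by linarith [ht.1]), fun s hs => hmin hs⟩

/-- The tail of a gamma distribution with small shape parameter `e` is of order
`e * (1 + log (1 / x))`. -/
theorem exists_gammaMeasure_Ioi_le (A : ℝ) :
    ∃ C : ℝ, 0 < C ∧ ∀ e, 0 < e → e ≤ A → ∀ x, 0 < x → x ≤ 1 →
      gammaMeasure e 1 (Set.Ioi x) ≤ ENNReal.ofReal (C * e * (1 - Real.log x)) := by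
  obtain ⟨c, hc, hcG⟩ := exists_gamma_lower_bound A
  by_cases hA : 0 < A
  swap
  · exact ⟨1, one_pos, fun e he heA => absurd (he.trans_le heA) hA⟩
  have hKi := Real.GammaIntegral_convergent (s := A + 1) (by linarith)
  set K : ℝ := ∫ t in Set.Ioi (0 : ℝ), Real.exp (-t) * t ^ (A + 1 - 1) with hK
  have hK0 : 0 ≤ K := setIntegral_nonneg measurableSet_Ioi fun t ht => by
    have : (0 : ℝ) < t := ht
    positivity
  have hKl : ∫⁻ t in Set.Ioi (0 : ℝ), ENNReal.ofReal (Real.exp (-t) * t ^ (A + 1 - 1)) =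
      ENNReal.ofReal K := by
    rw [hK, ofReal_integral_eq_lintegral_ofReal hKi]
    refine (ae_restrict_iff' measurableSet_Ioi).2 (ae_of_all _ fun t ht => ?_)
    have : (0 : ℝ) < t := ht
    simp only [Pi.zero_apply]
    positivity
  refine ⟨(1 + K) / c, by positivity, fun e he heA x hx hx1 => ?_⟩
  have hG : Real.Gamma e = Real.Gamma (e + 1) / e := by
    rw [Real.Gamma_add_one he.ne']; field_simp
  have hGc := hcG e ⟨he.le, heA⟩
  have hGp : (Real.Gamma e)⁻¹ ≤ e / c := by
    rw [hG, inv_div]; gcongr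
  have hlog : 0 ≤ -Real.log x := by linarith [Real.log_nonpos hx.le hx1]
  rw [gammaMeasure_one_eq, withDensity_apply _ measurableSet_Ioi, ← Set.Ioc_union_Ioi_eq_Ioi hx1]
  calc _ ≤ (∫⁻ t in Set.Ioc x 1, ENNReal.ofReal (gammaDensity e t)) +
        ∫⁻ t in Set.Ioi 1, ENNReal.ofReal (gammaDensity e t) := lintegral_union_le _ _ _
    _ ≤ (∫⁻ t in Set.Ioc x 1, ENNReal.ofReal (e / c) * ENNReal.ofReal t⁻¹) +
        ∫⁻ t in Set.Ioi 0, ENNReal.ofReal (e / c) *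
          ENNReal.ofReal (Real.exp (-t) * t ^ (A + 1 - 1)) := by
      -- On `(x, 1]` the density is at most `(e / c) / t`, which produces the logarithm; beyond `1`,
      -- `t ^ (e - 1) ≤ t ^ A` bounds it by a multiple of the integrand of `Γ(A + 1)`.
      refine add_le_add (setLIntegral_mono' measurableSet_Ioc fun t ht => ?_)
        ((setLIntegral_mono' measurableSet_Ioi fun t ht => ?_).trans
          (lintegral_mono_set (Set.Ioi_subset_Ioi zero_le_one)))
      · have ht0 : 0 < t := hx.trans ht.1
        rw [← ENNReal.ofReal_mul (by positivity), gammaDensity, if_pos ht0, div_eq_inv_mul]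
        refine ENNReal.ofReal_le_ofReal (mul_le_mul hGp ?_ (by positivity) (by positivity))
        calc t ^ (e - 1) * Real.exp (-t) ≤ t ^ (-1 : ℝ) * 1 := by
              refine mul_le_mul (Real.rpow_le_rpow_of_exponent_ge ht0 ht.2 (by linarith))
                (Real.exp_le_one_iff.2 (by linarith)) (by positivity) (by positivity)
          _ = t⁻¹ := by rw [mul_one, Real.rpow_neg_one]
      · have ht1 : (1 : ℝ) < t := ht
        have ht0 : 0 < t := zero_lt_one.trans ht1
        rw [← ENNReal.ofReal_mul (by positivity), gammaDensity, if_pos ht0, div_eq_inv_mul]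
        refine ENNReal.ofReal_le_ofReal (mul_le_mul hGp ?_ (by positivity) (by positivity))
        rw [mul_comm]
        gcongr
        · exact ht1.le
        · linarith
    _ = ENNReal.ofReal (e / c * (-Real.log x) + e / c * K) := by
      rw [lintegral_const_mul' _ _ (by simp), lintegral_const_mul' _ _ (by simp), hKl,
        lintegral_inv_Ioc hx hx1, ENNReal.ofReal_add (by positivity) (by positivity),
        ENNReal.ofReal_mul (by positivity), ENNReal.ofReal_mul (by positivity)]
    _ ≤ _ := by
      refine ENNReal.ofReal_le_ofReal ?_
      have : (1 + K) / c * e * (1 - Real.log x) - (e / c * (-Real.log x) + e / c * K) =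
        e / c * (1 + K * (-Real.log x)) := by ring
      have : 0 ≤ e / c * (1 + K * (-Real.log x)) := by positivity
      linarith

theorem gammaMeasure_Ioi_pos {a : ℝ} (ha : 0 < a) (x : ℝ) : 0 < gammaMeasure a 1 (Set.Ioi x) := by
  rw [pos_iff_ne_zero, gammaMeasure_one_eq, withDensity_apply _ measurableSet_Ioi, Ne,
    lintegral_eq_zero_iff (measurable_gammaDensity a).ennreal_ofReal]
  intro h
  have h2 : ∀ᵐ t ∂volume.restrict (Set.Ioi (max x 0)), False := by
    have h3 := ae_restrict_of_ae_restrict_of_subset (Set.Ioi_subset_Ioi (le_max_left x 0)) h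
    filter_upwards [h3, ae_restrict_mem measurableSet_Ioi] with t ht htm
    have ht0 : 0 < t := (le_max_right x 0).trans_lt htm
    have := Real.Gamma_pos_of_pos ha
    simp only [gammaDensity, if_pos ht0, Pi.zero_apply, ENNReal.ofReal_eq_zero] at ht
    exact absurd ht (not_le.2 (by positivity))
  rw [eventually_false_iff_eq_bot, ae_eq_bot, Measure.restrict_eq_zero] at h2
  simp at h2

namespace IsDirichletProcess

variable {Ω S : Type*} [MeasurableSpace Ω] [MeasurableSpace S] {α : Measure Ω}
  [IsFiniteMeasure α] {P : Measure S} {m : Kernel S Ω}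

/-- The mass of `A` is distributed as `Y / T`, with `Y` one of two gamma variables and `T` their
sum. If `Y / T > x` and `T > 1`, then `Y > x`; since `Y / T` and `T` are independent, the first two
probabilities multiply. -/
theorem measure_lt_mass_mul_le (hm : IsDirichletProcess α P m) {A : Set Ω} (hA : MeasurableSet A)
    (hA0 : 0 < α A) (hA1 : 0 < α Aᶜ) {x : ℝ} (hx : 0 < x) :
    P {s | x < (m s).real A} * gammaMeasure (α.real Set.univ) 1 (Set.Ioi 1) ≤
      gammaMeasure (α.real A) 1 (Set.Ioi x) := by
  let D : Bool → Set Ω := fun b => cond b A Aᶜ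
  have hlaw := hm.hasLaw_masses (D := D) (fun b => by cases b <;> simp [D, hA])
    (fun b c hbc => by
      cases b <;> cases c <;> simp_all [Function.onFun, D, disjoint_compl_left,
        disjoint_compl_right])
    (by
      have : (⋃ b, D b) = Set.univ := by ext ω; simp [D, em']
      simp [this])
    (fun b => by cases b <;> simp [D, hA0, hA1])
  have ha : ∀ b, 0 < α.real (D b) := fun b => by
    cases b <;> simp [D, measureReal_def, ENNReal.toReal_pos_iff, hA0, hA1, measure_lt_top]
  have := isProbabilityMeasure_gammaPi ha
  have := isProbabilityMeasure_gammaMeasure_one ha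
  obtain ⟨hsum, hind⟩ := indepFun_sum_proportions ha
  have htotal : ∑ b, α.real (D b) = α.real Set.univ := by
    simp [D, measureReal_add_measureReal_compl hA]
  have h1 : P {s | x < (m s).real A} =
      gammaPi (fun b => α.real (D b)) (proportions ⁻¹' {u | x < u true}) := by
    have hmeas : MeasurableSet {u : Bool → ℝ | x < u true} :=
      measurableSet_lt measurable_const (measurable_pi_apply _)
    rw [← Measure.map_apply measurable_proportions hmeas, ← hlaw.map_eq,
      Measure.map_apply_of_aemeasurable hlaw.aemeasurable hmeas]
    rfl
  have h2 : gammaMeasure (α.real Set.univ) 1 (Set.Ioi 1) =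
      gammaPi (fun b => α.real (D b)) ((fun y => ∑ b, y b) ⁻¹' Set.Ioi 1) := by
    rw [← htotal, ← hsum.map_eq, Measure.map_apply (by fun_prop) measurableSet_Ioi]
  have h3 : gammaMeasure (α.real A) 1 (Set.Ioi x) =
      gammaPi (fun b => α.real (D b)) ((fun y => y true) ⁻¹' Set.Ioi x) := by
    have := (measurePreserving_eval (fun b => gammaMeasure (α.real (D b)) 1) true).map_eq
    rw [← Measure.map_apply (by fun_prop) measurableSet_Ioi]
    exact congrArg (fun μ => μ (Set.Ioi x)) this.symm
  rw [h1, h2, h3, mul_comm, ← hind.measure_inter_preimage_eq_mul _ _ measurableSet_Ioi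
    (measurableSet_lt measurable_const (measurable_pi_apply _))]
  refine measure_mono fun y hy => ?_
  have hy1 : 1 < ∑ b, y b := hy.1
  have hy2 : x < y true / ∑ b, y b := hy.2
  rw [lt_div_iff₀ (by linarith)] at hy2
  have : x < y true := by nlinarith
  exact this

theorem exists_measure_lt_mass_le [IsProbabilityMeasure P]
    (hm : IsDirichletProcess α P m) (hα : α ≠ 0) :
    ∃ C : ENNReal, C ≠ ⊤ ∧ ∀ A, MeasurableSet A → ∀ x, 0 < x → x ≤ 1 →
      P {s | x < (m s).real A} ≤ C * ENNReal.ofReal (1 - Real.log x) * α A := by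
  have hα' : α Set.univ ≠ 0 := by simpa using hα
  have ha : 0 < α.real Set.univ := ENNReal.toReal_pos hα' (measure_ne_top _ _)
  obtain ⟨C, hC, hCb⟩ := exists_gammaMeasure_Ioi_le (α.real Set.univ)
  set q := gammaMeasure (α.real Set.univ) 1 (Set.Ioi 1) with hq
  have hq0 : q ≠ 0 := (gammaMeasure_Ioi_pos ha 1).ne'
  have hq1 : q ≠ ⊤ := by
    have := isProbabilityMeasure_gammaMeasure ha one_pos
    exact measure_ne_top _ _
  -- The second entry of the maximum serves the case `α Aᶜ = 0`, where the two-cell argument is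
  -- unavailable and only `P ≤ 1` is used.
  refine ⟨max (ENNReal.ofReal C / q) (α Set.univ)⁻¹, ?_, fun A hA x hx hx1 => ?_⟩
  · exact (max_lt (ENNReal.div_lt_top (by simp) hq0)
      (ENNReal.inv_lt_top.2 (pos_iff_ne_zero.2 hα'))).ne
  have hlog := Real.log_nonpos hx.le hx1
  rcases eq_zero_or_pos (α A) with h0 | h0
  · have : P {s | x < (m s).real A} = 0 := by
      refine measure_mono_null (fun s hs => ?_) (ae_iff.1 (hm.null A hA h0))
      intro h
      have : x < (m s).real A := hs
      rw [measureReal_def, h] at this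
      simp at this; linarith
    simp [this]
  rcases eq_zero_or_pos (α Aᶜ) with h1 | h1
  · have hAu : α A = α Set.univ := by rw [← measure_add_measure_compl hA, h1, add_zero]
    calc P {s | x < (m s).real A} ≤ 1 := prob_le_one
      _ = (α Set.univ)⁻¹ * 1 * α A := by
        rw [hAu, mul_one, ENNReal.inv_mul_cancel hα' (measure_ne_top _ _)]
      _ ≤ _ := by
        gcongr
        · exact le_max_right _ _
        · rw [← ENNReal.ofReal_one]
          exact ENNReal.ofReal_le_ofReal (by linarith)
  · have hpos : 0 < α.real A := ENNReal.toReal_pos h0.ne' (measure_ne_top _ _)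
    have h := (hm.measure_lt_mass_mul_le hA h0 h1 hx).trans
      (hCb _ hpos (measureReal_mono (Set.subset_univ _)) x hx hx1)
    rw [← hq, ← ENNReal.le_div_iff_mul_le (Or.inl hq0) (Or.inl hq1)] at h
    refine h.trans ?_
    rw [ENNReal.ofReal_mul (by positivity), ENNReal.ofReal_mul hC.le, measureReal_def,
      ENNReal.ofReal_toReal (measure_ne_top _ _), ENNReal.div_eq_inv_mul]
    calc _ = ENNReal.ofReal C / q * ENNReal.ofReal (1 - Real.log x) * α A := by
          rw [ENNReal.div_eq_inv_mul]; ring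
      _ ≤ _ := by gcongr; exact le_max_left _ _

/-- A function with finite logarithmic `α`-moment is almost surely integrable with respect to the
Dirichlet process. -/
theorem ae_integrable [IsProbabilityMeasure P] (hm : IsDirichletProcess α P m) (hα : α ≠ 0)
    {g : Ω → ℝ} (hg : Measurable g)
    (hlog : Integrable (fun ω => Real.log (1 + |g ω|)) α) : ∀ᵐ s ∂P, Integrable g (m s) := by
  have := hm.markov
  obtain ⟨C, hC, hCb⟩ := hm.exists_measure_lt_mass_le hα
  -- Dyadic levels: `2 ^ N ≤ 1 + |g| < 2 ^ (N + 1)`. The threshold `4⁻ᵏ` for the mass of level `k`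
  -- makes `2 ^ (k + 1) * 4⁻ᵏ` summable, while its logarithm costs only `k * log 4`, which the
  -- logarithmic moment pays for.
  let N : Ω → ℕ := fun ω => ⌊Real.logb 2 (1 + |g ω|)⌋₊
  have hN : Measurable N := Nat.measurable_floor.comp (by unfold Real.logb; fun_prop)
  let A : ℕ → Set Ω := fun k => N ⁻¹' {k}
  have hA : ∀ k, MeasurableSet (A k) := fun k => hN (measurableSet_singleton k)
  have hsum : ∀ (μ : Measure Ω) (w : ℕ → ENNReal), ∫⁻ ω, w (N ω) ∂μ = ∑' k, w k * μ (A k) := by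
    intro μ w
    rw [← lintegral_map (measurable_of_countable w) hN, lintegral_countable']
    exact tsum_congr fun k => by rw [Measure.map_apply hN (measurableSet_singleton k)]
  have hNlog : ∀ ω, (N ω : ℝ) ≤ Real.logb 2 (1 + |g ω|) := fun ω =>
    Nat.floor_le (Real.logb_nonneg one_lt_two (by linarith [abs_nonneg (g ω)]))
  have hfin : ∑' k : ℕ, ENNReal.ofReal (1 + k * Real.log 4) * α (A k) ≠ ⊤ := by
    rw [← hsum α]
    have hi : Integrable (fun ω => 1 + Real.logb 2 (1 + |g ω|) * Real.log 4) α := by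
      unfold Real.logb
      exact (integrable_const 1).add ((hlog.div_const _).mul_const _)
    refine ne_top_of_le_ne_top hi.lintegral_lt_top.ne (lintegral_mono fun ω => ?_)
    refine ENNReal.ofReal_le_ofReal ?_
    have := Real.log_nonneg (show (1 : ℝ) ≤ 4 by norm_num)
    gcongr
    exact hNlog ω
  have hBC : ∑' k : ℕ, P {s | (1 / 4 : ℝ) ^ k < (m s).real (A k)} ≠ ⊤ := by
    refine ne_top_of_le_ne_top (ENNReal.mul_ne_top hC hfin) ?_
    rw [← ENNReal.tsum_mul_left]
    refine ENNReal.tsum_le_tsum fun k => ?_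
    refine (hCb (A k) (hA k) _ (by positivity) (pow_le_one₀ (by norm_num) (by norm_num))).trans ?_
    rw [mul_assoc, Real.log_pow, one_div, Real.log_inv]
    ring_nf; rfl
  filter_upwards [ae_eventually_notMem hBC] with s hs
  refine ⟨hg.aestronglyMeasurable, ?_⟩
  have hs' : Summable fun k : ℕ => (2 : ℝ) ^ (k + 1) * (m s).real (A k) := by
    refine Summable.of_norm_bounded_eventually_nat (g := fun k => 2 * (1 / 2 : ℝ) ^ k)
      (summable_geometric_two.mul_left 2) ?_
    filter_upwards [hs] with k hk
    have hk' : (m s).real (A k) ≤ (1 / 4 : ℝ) ^ k := not_lt.1 hk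
    rw [Real.norm_of_nonneg (by positivity)]
    calc (2 : ℝ) ^ (k + 1) * (m s).real (A k) ≤ 2 ^ (k + 1) * (1 / 4) ^ k := by gcongr
      _ = 2 * (1 / 2 : ℝ) ^ k := by
        rw [pow_succ, mul_comm _ (2 : ℝ), mul_assoc, ← mul_pow]; norm_num
  calc ∫⁻ ω, ‖g ω‖ₑ ∂(m s) ≤ ∫⁻ ω, ENNReal.ofReal (2 ^ (N ω + 1)) ∂(m s) := by
        refine lintegral_mono fun ω => ?_
        rw [← ofReal_norm]
        refine ENNReal.ofReal_le_ofReal ?_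
        have hpos : 0 < 1 + |g ω| := by positivity
        have h1 := (Nat.lt_floor_add_one (Real.logb 2 (1 + |g ω|))).le
        rw [Real.logb_le_iff_le_rpow one_lt_two hpos] at h1
        have h2 : (2 : ℝ) ^ ((N ω : ℝ) + 1) = 2 ^ (N ω + 1) := by
          rw [← Real.rpow_natCast]; push_cast; rfl
        rw [Real.norm_eq_abs, ← h2]
        linarith
    _ = ∑' k : ℕ, ENNReal.ofReal (2 ^ (k + 1) * (m s).real (A k)) := by
        rw [hsum (m s) fun k => ENNReal.ofReal (2 ^ (k + 1))]
        refine tsum_congr fun k => ?_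
        rw [ENNReal.ofReal_mul (by positivity), measureReal_def,
          ENNReal.ofReal_toReal (measure_ne_top _ _)]
    _ < ⊤ := hs'.tsum_ofReal_lt_top

end IsDirichletProcess

/-! ### Independence of cell masses and cell averages -/

/-- Independence can be tested on bounded continuous functions, whose expectations pass to almost
sure limits by dominated convergence. It carries the case of simple functions over to `f`. -/
theorem indepFun_of_tendsto {Ω G H : Type*} [MeasurableSpace Ω] {P : Measure Ω}
    [IsFiniteMeasure P]
    [TopologicalSpace G] [MeasurableSpace G] [BorelSpace G] [HasOuterApproxClosed G]
    [TopologicalSpace H] [MeasurableSpace H] [BorelSpace H] [HasOuterApproxClosed H]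
    {W : Ω → G} {X : Ω → H} {Y : ℕ → Ω → H} (hW : AEMeasurable W P) (hX : AEMeasurable X P)
    (hY : ∀ n, AEMeasurable (Y n) P) (hlim : ∀ᵐ ω ∂P, Tendsto (fun n => Y n ω) atTop (𝓝 (X ω)))
    (h : ∀ n, IndepFun W (Y n) P) : IndepFun W X P := by
  refine indepFun_of_bcf hW hX fun φ ψ => ?_
  have hφ : AEStronglyMeasurable (φ ∘ W) P :=
    (φ.continuous.measurable.comp_aemeasurable hW).aestronglyMeasurable
  have hψ : ∀ n, AEStronglyMeasurable (ψ ∘ Y n) P := fun n =>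
    (ψ.continuous.measurable.comp_aemeasurable (hY n)).aestronglyMeasurable
  have hc : ∀ᵐ ω ∂P, Tendsto (fun n => (ψ ∘ Y n) ω) atTop (𝓝 ((ψ ∘ X) ω)) := by
    filter_upwards [hlim] with ω hω
    exact (ψ.continuous.tendsto _).comp hω
  have h1 : Tendsto (fun n => ∫ ω, (φ ∘ W * ψ ∘ Y n) ω ∂P) atTop
      (𝓝 (∫ ω, (φ ∘ W * ψ ∘ X) ω ∂P)) := by
    refine tendsto_integral_of_dominated_convergence (fun _ => ‖φ‖ * ‖ψ‖)
      (fun n => hφ.mul (hψ n)) (integrable_const _) (fun n => ae_of_all _ fun ω => ?_) ?_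
    · rw [Pi.mul_apply, norm_mul]
      exact mul_le_mul (φ.norm_coe_le_norm _) (ψ.norm_coe_le_norm _) (norm_nonneg _)
        (norm_nonneg _)
    · filter_upwards [hc] with ω hω
      exact hω.const_mul _
  have h2 : Tendsto (fun n => ∫ ω, (ψ ∘ Y n) ω ∂P) atTop (𝓝 (∫ ω, (ψ ∘ X) ω ∂P)) :=
    tendsto_integral_of_dominated_convergence (fun _ => ‖ψ‖) hψ (integrable_const _)
      (fun n => ae_of_all _ fun ω => ψ.norm_coe_le_norm _) hc
  refine tendsto_nhds_unique h1 ((h2.const_mul _).congr fun n => ?_)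
  exact (((h n).comp φ.continuous.measurable ψ.continuous.measurable).integral_mul_eq_mul_integral
    hφ (hψ n)).symm

section Kernel

variable {Ω S E : Type*} [MeasurableSpace Ω] [MeasurableSpace S]
  [NormedAddCommGroup E] [NormedSpace ℝ E] [MeasurableSpace E] [BorelSpace E]
  [SecondCountableTopology E]

theorem measurable_kernel_real (m : Kernel S Ω) {C : Set Ω} (hC : MeasurableSet C) :
    Measurable fun s => (m s).real C :=
  (m.measurable_coe hC).ennreal_toReal

theorem measurable_kernel_setAverage (m : Kernel S Ω) [IsMarkovKernel m] {C : Set Ω}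
    (hC : MeasurableSet C) {f : Ω → E} (hf : Measurable f) :
    Measurable fun s => ⨍ ω in C, f ω ∂(m s) := by
  simp only [setAverage_eq, ← integral_indicator hC]
  exact (measurable_kernel_real m hC).inv.smul
    ((hf.indicator hC).stronglyMeasurable.integral_kernel (κ := m)).measurable

namespace IsDirichletProcess

variable {α : Measure Ω} [IsFiniteMeasure α] {P : Measure S}
  {m : Kernel S Ω} {ι : Type*} [Fintype ι] {C : ι → Set Ω}

/-- Refining the cells by the level sets of `g` makes each average a combination of fixed values,
weighted by proportions within one cell, while the cell masses are block sums. So the block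
independence of gamma vectors applies. -/
theorem indepFun_masses_setAverage_simpleFunc [CompleteSpace E] [IsProbabilityMeasure P]
    [Nonempty ι] (hm : IsDirichletProcess α P m)
    (hC : ∀ i, MeasurableSet (C i)) (hdisj : Pairwise (Function.onFun Disjoint C))
    (hcover : α (⋃ i, C i)ᶜ = 0) (hpos : ∀ i, 0 < α (C i)) (g : SimpleFunc Ω E) :
    IndepFun (fun s i => (m s).real (C i)) (fun s i => ⨍ ω in C i, g ω ∂(m s)) P := by
  classical
  have := hm.markov
  -- Only values taken on a set of positive `α`-measure are kept, since gamma parameters must be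
  -- positive; the discarded pieces have random mass zero almost surely.
  let κ : ι → Type _ := fun i => {y : g.range // 0 < α (C i ∩ g ⁻¹' {y.1})}
  have hmem : ∀ ω, g ω ∈ g.range := fun ω => SimpleFunc.mem_range_self g ω
  have hcell : ∀ i y, MeasurableSet (C i ∩ g ⁻¹' {y}) := fun i y =>
    (hC i).inter (g.measurableSet_fiber y)
  have hne : ∀ i, Nonempty (κ i) := fun i => by
    by_contra hcon
    rw [not_nonempty_iff] at hcon
    refine (hpos i).ne' (measure_mono_null (t := ⋃ y : g.range, C i ∩ g ⁻¹' {y.1})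
      (fun ω hω => Set.mem_iUnion.2 ⟨⟨g ω, hmem ω⟩, hω, rfl⟩) ?_)
    refine measure_iUnion_null fun y => ?_
    by_contra h
    exact hcon.false ⟨y, pos_iff_ne_zero.2 h⟩
  have hne' : Nonempty (Σ i, κ i) := ⟨⟨Classical.arbitrary ι, Classical.arbitrary _⟩⟩
  let D : (Σ i, κ i) → Set Ω := fun p => C p.1 ∩ g ⁻¹' {p.2.1.1}
  have hD : ∀ p, MeasurableSet (D p) := fun p => hcell _ _
  have hDdisj : Pairwise (Function.onFun Disjoint D) := by
    rintro ⟨i, y⟩ ⟨j, z⟩ hne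
    refine Set.disjoint_left.2 fun ω h1 h2 => hne ?_
    have hij : i = j := by
      by_contra hij
      exact Set.disjoint_left.1 (hdisj hij) h1.1 h2.1
    subst hij
    have : y = z := Subtype.ext (Subtype.ext (h1.2.symm.trans h2.2))
    rw [this]
  have hDcover : α (⋃ p, D p)ᶜ = 0 := by
    refine measure_mono_null (t := (⋃ i, C i)ᶜ ∪
      ⋃ i, ⋃ y : {y : g.range // α (C i ∩ g ⁻¹' {y.1}) = 0}, C i ∩ g ⁻¹' {y.1.1})
      (fun ω hω => ?_) (measure_union_null hcover
        (measure_iUnion_null fun i => measure_iUnion_null fun y => y.2))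
    by_cases h : ω ∈ ⋃ i, C i
    · obtain ⟨i, hi⟩ := Set.mem_iUnion.1 h
      refine Or.inr (Set.mem_iUnion.2 ⟨i, Set.mem_iUnion.2 ⟨⟨⟨g ω, hmem ω⟩, ?_⟩, hi, rfl⟩⟩)
      by_contra h0
      exact hω (Set.mem_iUnion.2 ⟨⟨i, ⟨⟨g ω, hmem ω⟩, pos_iff_ne_zero.2 h0⟩⟩, hi, rfl⟩)
    · exact Or.inl h
  have hDpos : ∀ p, 0 < α (D p) := fun p => p.2.2
  have ha : ∀ p, 0 < α.real (D p) := fun p =>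
    ENNReal.toReal_pos (hDpos p).ne' (measure_ne_top _ _)
  have hlaw := hm.hasLaw_masses hD hDdisj hDcover hDpos
  let F₁ : ((Σ i, κ i) → ℝ) → ι → ℝ := fun u i => ∑ j, u ⟨i, j⟩
  let Q : ((Σ i, κ i) → ℝ) → ∀ i, κ i → ℝ := fun u i => proportions fun j => u ⟨i, j⟩
  let V : (∀ i, κ i → ℝ) → ι → E := fun q i => ∑ j, q i j • (j.1.1 : E)
  have hF₁ : Measurable F₁ := by fun_prop
  have hQ : Measurable Q :=
    measurable_pi_lambda _ fun i => measurable_proportions.comp (by fun_prop)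
  have hV : Measurable V := measurable_pi_lambda _ fun i =>
    Finset.measurable_fun_sum _ fun j _ => Measurable.smul_const (by fun_prop) _
  have := isProbabilityMeasure_gammaPi ha
  have hgamma : IndepFun F₁ Q ((gammaPi fun p => α.real (D p)).map proportions) := by
    rw [indepFun_map_iff measurable_proportions.aemeasurable hF₁ hQ]
    -- Masses are normalized by the grand total. Block masses become the proportions of the block
    -- sums, and within a block the grand total cancels.
    refine ((indepFun_blockSum_blockProportions ha).comp measurable_proportions
      measurable_id).congr (ae_of_all _ fun x => ?_) ?_
    · funext i
      simp only [Function.comp_apply, proportions, F₁, ← Finset.sum_div, Fintype.sum_sigma]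
    · filter_upwards [ae_sum_pos_gammaPi ha] with x hx
      funext i j
      simp only [Function.comp_apply, id, proportions, Q, ← Finset.sum_div]
      rw [div_div_div_cancel_right₀ hx.ne']
  rw [← hlaw.map_eq, indepFun_map_iff hlaw.aemeasurable hF₁ hQ] at hgamma
  have hae : ∀ᵐ s ∂P, ∀ i, (m s).real (C i) = ∑ j, (m s).real (D ⟨i, j⟩) ∧
      ∫ ω in C i, g ω ∂(m s) = ∑ j : κ i, (m s).real (D ⟨i, j⟩) • (j.1.1 : E) := by
    filter_upwards [hm.null _ (MeasurableSet.iUnion hD).compl hDcover] with s hs i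
    have hsub : ⋃ j : κ i, D ⟨i, j⟩ ⊆ C i := Set.iUnion_subset fun j => Set.inter_subset_left
    have hCD : C i =ᵐ[m s] ⋃ j : κ i, D ⟨i, j⟩ := by
      refine ae_eq_set.2 ⟨measure_mono_null (fun ω hω => ?_) hs, ?_⟩
      · intro h
        obtain ⟨⟨k, j⟩, hkj⟩ := Set.mem_iUnion.1 h
        have hik : k = i := by
          by_contra hne
          exact Set.disjoint_left.1 (hdisj hne) hkj.1 hω.1
        subst hik
        exact hω.2 (Set.mem_iUnion.2 ⟨j, hkj⟩)
      · rw [Set.sdiff_eq_empty.2 hsub, measure_empty]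
    have hdj : Pairwise (Function.onFun Disjoint fun j : κ i => D ⟨i, j⟩) := fun j k hjk =>
      hDdisj fun h => hjk (by simpa using h)
    constructor
    · rw [measureReal_congr hCD, measureReal_iUnion_fintype hdj fun j => hD _]
    · rw [setIntegral_congr_set hCD, integral_iUnion_fintype (fun j => hD _) hdj
        fun j => (g.integrable_of_isFiniteMeasure).integrableOn]
      refine Finset.sum_congr rfl fun j _ => ?_
      rw [setIntegral_congr_fun (f := g) (g := fun _ => (j.1.1 : E)) (hD ⟨i, j⟩) fun ω hω => hω.2,
        setIntegral_const]
  refine (hgamma.comp measurable_id hV).congr ?_ ?_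
  · filter_upwards [hae] with s hs
    exact funext fun i => (hs i).1.symm
  · filter_upwards [hae] with s hs
    funext i
    rw [setAverage_eq, (hs i).2, (hs i).1, Finset.smul_sum]
    refine Finset.sum_congr rfl fun j _ => ?_
    rw [smul_smul, ← div_eq_inv_mul]
    rfl

/-- The masses of the cells of a partition are independent of the averages over the cells. -/
theorem indepFun_masses_setAverage [CompleteSpace E] [IsProbabilityMeasure P]
    [Nonempty ι] (hm : IsDirichletProcess α P m)
    (hC : ∀ i, MeasurableSet (C i)) (hdisj : Pairwise (Function.onFun Disjoint C))
    (hcover : α (⋃ i, C i)ᶜ = 0) (hpos : ∀ i, 0 < α (C i)) {f : Ω → E} (hf : Measurable f)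
    (hfi : ∀ᵐ s ∂P, Integrable f (m s)) :
    IndepFun (fun s i => (m s).real (C i)) (fun s i => ⨍ ω in C i, f ω ∂(m s)) P := by
  have := hm.markov
  let g : ℕ → SimpleFunc Ω E := SimpleFunc.approxOn f hf Set.univ 0 trivial
  refine indepFun_of_tendsto (Y := fun n s i => ⨍ ω in C i, g n ω ∂(m s))
    (measurable_pi_lambda _ fun i => measurable_kernel_real m (hC i)).aemeasurable
    (measurable_pi_lambda _ fun i => measurable_kernel_setAverage m (hC i) hf).aemeasurable
    (fun n => (measurable_pi_lambda _ fun i =>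
      measurable_kernel_setAverage m (hC i) (g n).measurable).aemeasurable) ?_
    fun n => hm.indepFun_masses_setAverage_simpleFunc hC hdisj hcover hpos (g n)
  filter_upwards [hfi] with s hs
  refine tendsto_pi_nhds.2 fun i => ?_
  simp only [setAverage_eq]
  refine Tendsto.const_smul (tendsto_integral_of_dominated_convergence
    (fun ω => ‖f ω‖ + ‖f ω‖) (fun n => (g n).aestronglyMeasurable)
    (hs.norm.add hs.norm).integrableOn
    (fun n => ae_of_all _ fun ω => SimpleFunc.norm_approxOn_zero_le hf (Set.mem_univ _) ω n)
    (ae_of_all _ fun ω => SimpleFunc.tendsto_approxOn hf (Set.mem_univ _) (by simp))) _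

theorem ae_mass_pos [Nonempty ι] (hm : IsDirichletProcess α P m)
    (hC : ∀ i, MeasurableSet (C i)) (hdisj : Pairwise (Function.onFun Disjoint C))
    (hcover : α (⋃ i, C i)ᶜ = 0) (hpos : ∀ i, 0 < α (C i)) :
    ∀ᵐ s ∂P, ∀ i, 0 < (m s).real (C i) := by
  have hlaw := hm.hasLaw_masses hC hdisj hcover hpos
  have ha : ∀ i, 0 < α.real (C i) := fun i =>
    ENNReal.toReal_pos (hpos i).ne' (measure_ne_top _ _)
  refine ae_of_ae_map hlaw.aemeasurable (p := fun u : ι → ℝ => ∀ i, 0 < u i) ?_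
  rw [hlaw.map_eq]
  refine (ae_map_iff measurable_proportions.aemeasurable ?_).2 ?_
  · simp only [Set.ofPred_forall]
    exact MeasurableSet.iInter fun i => measurableSet_lt measurable_const (measurable_pi_apply i)
  · filter_upwards [ae_pos_gammaPi ha] with x hx i
    exact div_pos (hx i) (Finset.sum_pos (fun k _ => hx k) Finset.univ_nonempty)

end IsDirichletProcess

end Kernel

/-! ### Affine geometry of the support -/

section Support

variable {d : ℕ}

/-- A measure on `ℝᵈ` that charges no affine hyperplane fully has a support that spans `ℝᵈ`
affinely. -/
theorem span_support_eq_top {μ : Measure (Fin d → ℝ)} [IsFiniteMeasure μ] (hμ : μ ≠ 0)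
    (h : ∀ v : Fin d → ℝ, v ≠ 0 → ∀ c : ℝ, μ {y | ∑ j, v j * y j = c} ≠ μ Set.univ) :
    Submodule.span ℝ ((fun y => ((1 : ℝ), y)) '' μ.support) = ⊤ := by
  -- In the coordinates `(1, y)` affine spanning becomes linear spanning. A nonzero functional `φ`
  -- killing the support is an affine equation; if its part `v` vanishes, a support point forces `φ
  -- = 0`, and otherwise it gives a hyperplane of full measure.
  by_contra hne
  obtain ⟨φ, hφ0, hφ⟩ := Submodule.exists_le_ker_of_lt_top _ (lt_top_iff_ne_top.2 hne)
  have hsupp : ∀ y ∈ μ.support, φ (1, y) = 0 := fun y hy =>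
    hφ (Submodule.subset_span ⟨y, hy, rfl⟩)
  let v : Fin d → ℝ := fun j => φ (0, Pi.single j 1)
  have hval : ∀ t y, φ (t, y) = t * φ (1, 0) + ∑ j, v j * y j := fun t y => by
    have hy : y = ∑ j, y j • (Pi.single j 1 : Fin d → ℝ) := by
      ext k; simp [Finset.sum_apply, Pi.single_apply]
    have hty : (t, y) = t • ((1 : ℝ), (0 : Fin d → ℝ)) +
        ∑ j, y j • ((0 : ℝ), (Pi.single j 1 : Fin d → ℝ)) := by
      rw [Prod.ext_iff]
      refine ⟨by simp [Prod.fst_sum], ?_⟩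
      simpa [Prod.snd_sum] using hy
    rw [hty, map_add, map_smul, map_sum]
    simp only [map_smul, smul_eq_mul, v]
    exact congrArg _ (Finset.sum_congr rfl fun j _ => mul_comm _ _)
  by_cases hv : v = 0
  · obtain ⟨y, hy⟩ := Measure.nonempty_support hμ
    have h1 := hsupp y hy
    rw [hval] at h1
    simp only [hv, Pi.zero_apply, zero_mul, Finset.sum_const_zero, add_zero, one_mul] at h1
    refine hφ0 (LinearMap.ext fun z => ?_)
    rw [← Prod.mk.eta (p := z), hval]
    simp [hv, h1]
  · refine h v hv (-φ (1, 0)) (measure_congr (eventuallyEq_univ.2 ?_))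
    filter_upwards [Measure.support_mem_ae (μ := μ)] with y hy
    have h1 := hsupp y hy
    rw [hval] at h1
    change ∑ j, v j * y j = -φ (1, 0)
    linarith

/-- Finitely many small balls of positive measure such that every choice of points in them is
affinely independent and spans `ℝᵈ`. -/
theorem exists_balls_spanning {μ : Measure (Fin d → ℝ)}
    (h : Submodule.span ℝ ((fun y => ((1 : ℝ), y)) '' μ.support) = ⊤) :
    ∃ (n : ℕ) (p : Fin n → Fin d → ℝ) (r : ℝ), 0 < r ∧
      (∀ k, 0 < μ (Metric.closedBall (p k) r)) ∧
      ∀ x : Fin n → Fin d → ℝ, (∀ k, x k ∈ Metric.closedBall (p k) r) →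
        LinearIndependent ℝ (fun k => ((1 : ℝ), x k)) ∧
        Submodule.span ℝ (Set.range fun k => ((1 : ℝ), x k)) = ⊤ := by
  obtain ⟨b, hbT, hbspan, hbli⟩ := exists_linearIndependent ℝ
    ((fun y => ((1 : ℝ), y)) '' μ.support)
  rw [h] at hbspan
  let B : Module.Basis b ℝ (ℝ × (Fin d → ℝ)) := Module.Basis.mk hbli (by simp [hbspan])
  have : Fintype b := FiniteDimensional.fintypeBasisIndex B
  let n := Fintype.card b
  let e : Fin n ≃ b := (Fintype.equivFin b).symm
  have hcard : Fintype.card (Fin n) = Module.finrank ℝ (ℝ × (Fin d → ℝ)) := by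
    rw [Module.finrank_eq_card_basis B, Fintype.card_fin]
  choose p hp hpb using fun k : Fin n => hbT (e k).2
  have hli : LinearIndependent ℝ fun k => ((1 : ℝ), p k) := by
    have : (fun k => ((1 : ℝ), p k)) = (Subtype.val : b → _) ∘ e := funext hpb
    rw [this]
    exact hbli.comp e e.injective
  have hopen : IsOpen {x : Fin n → Fin d → ℝ | LinearIndependent ℝ fun k => ((1 : ℝ), x k)} :=
    isOpen_setOfPred_linearIndependent.preimage
      (f := fun (x : Fin n → Fin d → ℝ) k => ((1 : ℝ), x k)) (by fun_prop)
  obtain ⟨r, hr, hball⟩ := Metric.nhds_basis_closedBall.mem_iff.1 (hopen.mem_nhds hli)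
  refine ⟨n, p, r, hr, fun k => ?_, fun x hx => ?_⟩
  · exact (Measure.mem_support_iff_forall _).1 (hp k) _ (Metric.closedBall_mem_nhds _ hr)
  · have hx' : LinearIndependent ℝ fun k => ((1 : ℝ), x k) :=
      hball (by rw [closedBall_pi _ hr.le]; exact fun k _ => hx k)
    exact ⟨hx', hx'.span_eq_top_of_card_eq_finrank' hcard⟩

end Support

/-! ### Absolute continuity of the mean vector -/

/-- The random convex combination of affinely spanning points, with weights proportional to
independent gamma variables, has an absolutely continuous law. -/
theorem gammaPi_proportions_sum_smul_mem_eq_zero {d : ℕ} {ι : Type*} [Fintype ι] {a : ι → ℝ}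
    (ha : ∀ i, 0 < a i) {x : ι → Fin d → ℝ}
    (hx : Submodule.span ℝ (Set.range fun i => ((1 : ℝ), x i)) = ⊤) {N : Set (Fin d → ℝ)}
    (hN : MeasurableSet N) (hN0 : volume N = 0) :
    ∀ᵐ g ∂gammaPi a, ∑ i, proportions g i • x i ∉ N := by
  -- The normalization is undone by homogeneity: `Z` is the cone over `N`, null because each slice
  -- at `t ≠ 0` is a dilate of `N`.
  let Z : Set (ℝ × (Fin d → ℝ)) := {z | z.1⁻¹ • z.2 ∈ N}
  have hZ : MeasurableSet Z :=
    (show Measurable fun z : ℝ × (Fin d → ℝ) => z.1⁻¹ • z.2 by fun_prop) hN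
  have hZ0 : ((volume : Measure ℝ).prod (volume : Measure (Fin d → ℝ))) Z = 0 := by
    rw [Measure.measure_prod_null hZ]
    filter_upwards [Measure.ae_ne volume (0 : ℝ)] with t ht
    change volume ((fun y : Fin d → ℝ => t⁻¹ • y) ⁻¹' N) = 0
    rw [Measure.addHaar_preimage_smul _ (inv_ne_zero ht), hN0, mul_zero]
  let L : (ι → ℝ) →ₗ[ℝ] ℝ × (Fin d → ℝ) :=
    Fintype.linearCombination ℝ fun i => ((1 : ℝ), x i)
  have hL : Function.Surjective L := by
    rw [← LinearMap.range_eq_top, Fintype.range_linearCombination, hx]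
  have h1 : ∀ᵐ g : ι → ℝ, L g ∈ Zᶜ :=
    (ae_comp_linearMap_mem_iff L volume (volume.prod volume) hL hZ.compl).2 (compl_mem_ae_iff.2 hZ0)
  filter_upwards [(gammaPi_absolutelyContinuous ha).ae_le h1] with g hg hmem
  refine hg ?_
  change (L g).1⁻¹ • (L g).2 ∈ N
  convert! hmem using 1
  simp only [L, Fintype.linearCombination_apply, Prod.fst_sum, Prod.snd_sum, Prod.smul_mk,
    Finset.smul_sum, proportions, smul_smul, div_eq_inv_mul, smul_eq_mul, mul_one]

theorem theorem10 {Ω S : Type*} [MeasurableSpace Ω] [MeasurableSpace S]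
    (α : Measure Ω) [IsFiniteMeasure α] (hα : α ≠ 0)
    (P : Measure S) [IsProbabilityMeasure P]
    (m : Kernel S Ω) (hm : IsDirichletProcess α P m)
    (d : ℕ) (f : Fin d → Ω → ℝ) (hf : ∀ k, Measurable (f k))
    (hlog : ∀ k, Integrable (fun ω => Real.log (1 + |f k ω|)) α)
    (hdeg : ¬ IsAffinelyDegenerate α f) :
    (∀ᵐ s ∂P, ∀ k, Integrable (f k) (m s)) ∧
      P.map (meanVector m f) ≪ (volume : Measure (Fin d → ℝ)) := by
  have := hm.markov
  have hint : ∀ᵐ s ∂P, ∀ k, Integrable (f k) (m s) :=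
    ae_all_iff.2 fun k => hm.ae_integrable hα (hf k) (hlog k)
  refine ⟨hint, ?_⟩
  let F : Ω → Fin d → ℝ := fun ω k => f k ω
  have hF : Measurable F := measurable_pi_lambda _ hf
  have hFint : ∀ᵐ s ∂P, Integrable F (m s) := by
    filter_upwards [hint] with s hs
    exact Integrable.of_eval hs
  have hμ : α.map F ≠ 0 := fun h => hα ((Measure.map_eq_zero_iff hF.aemeasurable).1 h)
  obtain ⟨n, p, r, hr, hball, hspan⟩ := exists_balls_spanning (span_support_eq_top hμ
    fun v hv c hc => hdeg ⟨v, hv, c, by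
      rw [Measure.map_apply hF (measurableSet_eq_fun (by fun_prop) measurable_const),
        Measure.map_apply hF MeasurableSet.univ] at hc
      exact hc⟩)
  let B : Fin n → Set Ω := fun k => F ⁻¹' Metric.closedBall (p k) r
  have hB : ∀ k, MeasurableSet (B k) := fun k => hF Metric.isClosed_closedBall.measurableSet
  have hB0 : ∀ k, 0 < α (B k) := fun k => by
    rw [← Measure.map_apply hF Metric.isClosed_closedBall.measurableSet]
    exact hball k
  -- A common point of two cells would be an admissible choice in both balls, giving a linearly
  -- independent family with a repeated vector.
  have hBdisj : Pairwise (Function.onFun Disjoint B) := fun j k hjk => by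
    refine Set.disjoint_left.2 fun ω hj hk => hjk ?_
    have h := (hspan (Function.update p j (F ω) |> fun q => Function.update q k (F ω))
      fun i => by
        by_cases hik : i = k
        · subst hik; simpa using! hk
        · by_cases hij : i = j
          · subst hij; simpa [hik] using! hj
          · simp [hik, hij, hr.le]).1.injective
    exact h (by simp [Function.update_of_ne hjk])
  -- The index `none` is the remainder; passing to `ι` drops it exactly when it is null, as the
  -- balls always have positive measure.
  let C₀ : Option (Fin n) → Set Ω := fun o => o.elim (⋃ k, B k)ᶜ B
  let ι := {o : Option (Fin n) // 0 < α (C₀ o)}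
  let C : ι → Set Ω := fun i => C₀ i.1
  have hC₀ : ∀ o, MeasurableSet (C₀ o)
    | none => (MeasurableSet.iUnion hB).compl
    | some k => hB k
  have hC : ∀ i, MeasurableSet (C i) := fun i => hC₀ i.1
  have hC₀disj : Pairwise (Function.onFun Disjoint C₀) := by
    have hR : ∀ k, Disjoint (B k) (⋃ k, B k)ᶜ := fun k =>
      Set.disjoint_compl_right_iff_subset.2 (Set.subset_iUnion B k)
    rintro (_ | j) (_ | k) hjk
    · exact absurd rfl hjk
    · exact (hR k).symm
    · exact hR j
    · exact hBdisj fun h => hjk (by rw [h])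
  have hdisj : Pairwise (Function.onFun Disjoint C) := fun i j hij =>
    hC₀disj fun h => hij (Subtype.ext h)
  have hcover : α (⋃ i, C i)ᶜ = 0 := by
    have hsub : ∀ ω ∉ ⋃ i, C i, ω ∈ C₀ none ∧ ¬ 0 < α (C₀ none) := fun ω hω => by
      have h1 : ω ∈ C₀ none := fun h => by
        obtain ⟨k, hk⟩ := Set.mem_iUnion.1 h
        exact hω (Set.mem_iUnion.2 ⟨⟨some k, hB0 k⟩, hk⟩)
      exact ⟨h1, fun h0 => hω (Set.mem_iUnion.2 ⟨⟨none, h0⟩, h1⟩)⟩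
    by_cases h0 : 0 < α (C₀ none)
    · exact measure_mono_null (fun ω hω => (hsub ω hω).2 h0) measure_empty
    · exact measure_mono_null (fun ω hω => (hsub ω hω).1) (by simpa using h0)
  have hpos : ∀ i, 0 < α (C i) := fun i => i.2
  have hne : Nonempty ι := by
    by_contra hcon
    rw [not_nonempty_iff] at hcon
    exact hα (by simpa using hcover)
  have := Fintype.ofFinite ι
  let W : S → ι → ℝ := fun s i => (m s).real (C i)
  let X : S → ι → Fin d → ℝ := fun s i => ⨍ ω in C i, F ω ∂(m s)
  have hXm : Measurable X :=
    measurable_pi_lambda _ fun i => measurable_kernel_setAverage m (hC i) hF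
  have hind : IndepFun W X P := hm.indepFun_masses_setAverage hC hdisj hcover hpos hF hFint
  have hWpos := hm.ae_mass_pos hC hdisj hcover hpos
  have hmean : ∀ᵐ s ∂P, meanVector m f s = ∑ i, W s i • X s i := by
    filter_upwards [hFint, hm.null _ (MeasurableSet.iUnion hC).compl hcover] with s hs hs0
    have h1 : meanVector m f s = ∫ ω, F ω ∂(m s) := by
      funext k
      exact (eval_integral (f := F) fun j => hs.eval j) k |>.symm
    rw [h1, ← setIntegral_univ,
      ← setIntegral_congr_set (eventuallyEq_univ.2 (mem_ae_iff.2 hs0 : (⋃ i, C i) ∈ ae (m s))),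
      integral_iUnion_fintype hC hdisj fun i => hs.integrableOn]
    exact Finset.sum_congr rfl fun i _ => (measure_smul_setAverage _ (measure_ne_top _ _)).symm
  have hXball : ∀ᵐ s ∂P, ∀ k : Fin n,
      X s ⟨some k, hB0 k⟩ ∈ Metric.closedBall (p k) r := by
    filter_upwards [hFint, hWpos] with s hs hW k
    refine (convex_closedBall (p k) r).set_average_mem Metric.isClosed_closedBall ?_
      (measure_ne_top _ _) ?_ hs.integrableOn
    · intro h0
      have := hW ⟨some k, hB0 k⟩
      rw [measureReal_def, h0] at this
      simp at this
    · exact (ae_restrict_iff' (hB k)).2 (ae_of_all _ fun ω hω => hω)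
  refine Measure.AbsolutelyContinuous.mk fun N hN hN0 => ?_
  rw [Measure.map_apply (measurable_meanVector m f hf) hN]
  have ha : ∀ i, 0 < α.real (C i) := fun i =>
    ENNReal.toReal_pos (hpos i).ne' (measure_ne_top _ _)
  have hWlaw : HasLaw W ((gammaPi fun i => α.real (C i)).map proportions) P :=
    hm.hasLaw_masses hC hdisj hcover hpos
  have := isProbabilityMeasure_gammaPi ha
  let T : Set ((ι → Fin d → ℝ) × (ι → ℝ)) := {z | ∑ i, z.2 i • z.1 i ∈ N}
  have hT : MeasurableSet T :=
    (show Measurable fun z : (ι → Fin d → ℝ) × (ι → ℝ) => ∑ i, z.2 i • z.1 i by fun_prop) hN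
  -- By independence the law of `(X, W)` is a product, so it suffices that the slice is null for
  -- almost every fixed `x`. The ball cells alone already span; the remainder cell does no harm.
  have hTnull : P.map (fun s => (X s, W s)) T = 0 := by
    rw [hind.symm.map_prod_eq_prod_map_map hXm.aemeasurable hWlaw.aemeasurable, hWlaw.map_eq,
      Measure.measure_prod_null hT]
    have hQ : MeasurableSet {x : ι → Fin d → ℝ |
        ∀ k : Fin n, x ⟨some k, hB0 k⟩ ∈ Metric.closedBall (p k) r} := by
      simp only [Set.ofPred_forall]
      exact MeasurableSet.iInter fun k =>
        (measurable_pi_apply _) Metric.isClosed_closedBall.measurableSet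
    filter_upwards [(ae_map_iff hXm.aemeasurable hQ).2 hXball] with x hx
    have hxspan : Submodule.span ℝ (Set.range fun i => ((1 : ℝ), x i)) = ⊤ := by
      refine top_unique (((hspan (fun k => x ⟨some k, hB0 k⟩) hx).2).ge.trans ?_)
      refine Submodule.span_mono ?_
      rintro _ ⟨k, rfl⟩
      exact ⟨⟨some k, hB0 k⟩, rfl⟩
    rw [Measure.map_apply measurable_proportions (measurable_prodMk_left hT)]
    have h := gammaPi_proportions_sum_smul_mem_eq_zero ha hxspan hN hN0
    rw [ae_iff] at h
    simpa [T] using! h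
  rw [Measure.map_apply_of_aemeasurable (hXm.aemeasurable.prodMk hWlaw.aemeasurable) hT] at hTnull
  refine measure_mono_null_ae ?_ hTnull
  filter_upwards [hmean] with s hs hsN
  change ∑ i, W s i • X s i ∈ N
  rw [← hs]
  exact hsN
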